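/- **Setting.** Let $S$ be a patch of a $k$-dimensional real analytic submanifold of $\mathbb E^n$, i.e. an analytic immersion $X:U\to\mathbb E^n$ of an open set $U\subset\mathbb R^k$ with coordinates $s=(s^1,\dots,s^k)$ (everything is local on $S$, and immersed submanifolds are allowed). Let $\Delta_S$ be the Beltrami–Laplace operator of the induced metric. For an open set $U$ of coordinates, $\mathcal D_U$ is the ring of operators on the complex valued real analytic functions on $U$ generated by multiplications with such functions and by the partial derivatives; $\mathcal D_S:=\mathcal D_U$. A tubular neighbourhood of $S$, in normal coordinates, consists of an analytic orthonormal frame $N_1,\dots,N_{n-k}$ of the normal bundle and an open neighbourhood $T$ of $\{q=0\}$ in $\{(s,q): s\in U,\ q\in\mathbb R^{n-k}\}$ on which $\Phi(s,q)=X(s)+\sum_a q^aN_a(s)$ is a local diffeomorphism. Let $g_T$ be the determinant of the metric $\Phi^*g_{\mathbb E^n}$, let $\Delta_T\in\mathcal D_T$ be the operator corresponding to the Euclidean Laplacian under $\Phi$ (so that the inverse image on $T$ of the Schrödinger system $\mathcal D_{\mathbb E^n}/\mathcal D_{\mathbb E^n}(-\Delta_{\mathbb E^n})$ is $\mathcal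 D_T/\mathcal D_T(-\Delta_T)$), and let $$\nabla_a:=g_T^{-1/4}\,\frac{\partial}{\partial q^a}\,g_T^{1/4}\qquad(a=1,\dots,n-k)$$ be the normal anti-self-adjoint connections (half-form conjugates of $\partial/\partial q^a$), so that the $\sqrt{-1}\,\nabla_a$ are self-adjoint. Every $P\in\mathcal D_T$ has on $q=0$ a unique standard form $P|_S=\sum_\gamma R_\gamma\nabla^\gamma$ with $R_\gamma\in\mathcal D_S$, that is, $(Pf)|_S=\sum_\gamma R_\gamma\bigl((\nabla^\gamma f)|_S\bigr)$ for all analytic $f$ on $T$. Let $\mathcal D_{S\to T}=\mathcal D_S[\nabla_1,\dots,\nabla_{n-k}]$ be the ring of such standard forms (coefficients frozen at $q=0$; the $\nabla_a$ are commuting variables, commuting with $\mathcal D_S$), and put $$\mathcal S_{S\to T}:=\mathcal D_{S\to T}/\mathcal D_{S\to T}(-\Delta_T|_S),\qquad \mathcal S_{S\hookrightarrow\mathbb E^n}:=\operatorname{coker}\Bigl((\mathcal S_{S\to T})^{n-k}\to\mathcal S_{S\to T},\ (P_a)_a\mapsto\sum_aP_a\nabla_a\Bigr),$$ the latter regarded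 as a $\mathcal D_S$-module (the submanifold Schrödinger system). A submanifold Schrödinger operator is an operator $\Delta_{S\hookrightarrow\mathbb E^n}\in\mathcal D_S$ such that $\Delta_{S\hookrightarrow\mathbb E^n}-\Delta_S$ is multiplication by an analytic function and the sequence $$0\to\mathcal D_S\xrightarrow{\ P\mapsto P(-\Delta_{S\hookrightarrow\mathbb E^n})\ }\mathcal D_S\xrightarrow{\ P\mapsto[P]\ }\mathcal S_{S\hookrightarrow\mathbb E^n}\to0$$ is exact. **Theorem 4.4.** In both cases below tubular neighbourhoods exist locally, and for every tubular neighbourhood there is exactly one submanifold Schrödinger operator. It is as follows. 1. ($k=1$, $n=3$.) Let $S=C$ be a real analytic curve in $\mathbb E^3$ parametrised by arclength $s$ on an open interval $I$. Then $$-\Delta_{C\hookrightarrow\mathbb E^3}=-\partial_s^2-\tfrac14|\kappa_{\mathbb C}|^2,\qquad \kappa_{\mathbb C}(s)=\kappa(s)\exp\Bigl(\sqrt{-1}\int_{s_0}^s\tau\,ds\Bigr),$$ for any base point $s_0\in I$, where $\kappa$ and $\tau$ are the Frenet–Serret curvature and torsion (and $\kappa_{\mathbb C}:=0$ where $\kappa=0$).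 It agrees with the operator $-\Delta_C-\tfrac14\kappa^2$ of Jensen–Koppe and da Costa. 2. ($k=2$, $n=3$.) Let $S$ be a real analytic surface patch in $\mathbb E^3$, with mean curvature $H$ and Gauss curvature $K$. Then $$-\Delta_{S\hookrightarrow\mathbb E^3}=-\Delta_S-(H^2-K).$$ It agrees with the operator $-\Delta_S-\tfrac14(k_1-k_2)^2$ of Jensen–Koppe and da Costa, where $k_1,k_2$ are the principal curvatures. -/

import Mathlib

open scoped InnerProductSpace Laplacian

noncomputable section

namespace SubmanifoldSchrodinger

/-! ### Analytic functions and differential operators on an open set of coordinates -/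

section Operators

variable {ι : Type}

/-- Extension by zero of a function on an open set. Only its germs at points of the open set
matter below. -/
def ext (U : TopologicalSpace.Opens (ι → ℝ)) (f : U → ℂ) : (ι → ℝ) → ℂ :=
  Function.extend Subtype.val f 0

lemma ext_apply (U : TopologicalSpace.Opens (ι → ℝ)) (f : U → ℂ) (x : U) : ext U f x = f x :=
  Subtype.val_injective.extend_apply f 0 x

lemma ext_eventuallyEq [Fintype ι] (U : TopologicalSpace.Opens (ι → ℝ)) (f : U → ℂ) (F : (ι → ℝ) → ℂ)
    (h : ∀ x : U, f x = F x) (x : U) : ext U f =ᶠ[nhds (x : ι → ℝ)] F := by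
  filter_upwards [U.isOpen.mem_nhds x.2] with y hy
  exact (ext_apply U f ⟨y, hy⟩).trans (h ⟨y, hy⟩)

lemma analyticAt_ext [Fintype ι] (U : TopologicalSpace.Opens (ι → ℝ)) (f : U → ℂ) (F : (ι → ℝ) → ℂ)
    (h : ∀ x : U, f x = F x) (hF : ∀ x : U, AnalyticAt ℝ F x) (x : U) :
    AnalyticAt ℝ (ext U f) x :=
  (hF x).congr (ext_eventuallyEq U f F h x).symm

variable [Fintype ι]

/-- The algebra of complex valued real analytic functions on `U`. -/
def analyticFunctions (U : TopologicalSpace.Opens (ι → ℝ)) : Subalgebra ℂ (U → ℂ) where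
  carrier := {f | ∀ x : U, AnalyticAt ℝ (ext U f) x}
  mul_mem' {f g} hf hg := analyticAt_ext U (f * g) (ext U f * ext U g)
    (fun x => by simp [ext_apply]) (fun x => (hf x).mul (hg x))
  add_mem' {f g} hf hg := analyticAt_ext U (f + g) (ext U f + ext U g)
    (fun x => by simp [ext_apply]) (fun x => (hf x).add (hg x))
  algebraMap_mem' c := analyticAt_ext U _ (fun _ => c) (fun _ => rfl)
    (fun _ => analyticAt_const)

/-- The type of complex valued real analytic functions on `U`. -/
def A (U : TopologicalSpace.Opens (ι → ℝ)) : Type := analyticFunctions U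

instance (U : TopologicalSpace.Opens (ι → ℝ)) : CommRing (A U) :=
  inferInstanceAs (CommRing (analyticFunctions U))

instance (U : TopologicalSpace.Opens (ι → ℝ)) : Algebra ℂ (A U) :=
  inferInstanceAs (Algebra ℂ (analyticFunctions U))

instance (U : TopologicalSpace.Opens (ι → ℝ)) : CoeFun (A U) (fun _ => U → ℂ) := ⟨Subtype.val⟩

@[ext] lemma A.ext {U : TopologicalSpace.Opens (ι → ℝ)} {f g : A U} (h : ∀ x, f x = g x) : f = g :=
  Subtype.ext (funext h)

/-- An analytic function on an ambient neighbourhood of `U`, as an element of `A U`. -/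
def A.of (U : TopologicalSpace.Opens (ι → ℝ)) (F : (ι → ℝ) → ℂ)
    (hF : ∀ x : U, AnalyticAt ℝ F x) : A U :=
  ⟨fun x => F x, analyticAt_ext U _ F (fun _ => rfl) hF⟩

variable [DecidableEq ι]

/-- The partial derivative in the `i`-th coordinate of a function on coordinate space. -/
def partialDeriv {F : Type} [NormedAddCommGroup F] [NormedSpace ℝ F] (i : ι)
    (f : (ι → ℝ) → F) (x : ι → ℝ) : F :=
  fderiv ℝ f x (Pi.single i 1)

lemma analyticAt_partialDeriv {F : Type} [NormedAddCommGroup F] [NormedSpace ℝ F]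
    [CompleteSpace F] (i : ι) {f : (ι → ℝ) → F} {x : ι → ℝ} (h : AnalyticAt ℝ f x) :
    AnalyticAt ℝ (partialDeriv i f) x :=
  ((ContinuousLinearMap.apply ℝ F (Pi.single i 1 : ι → ℝ)).analyticAt _).comp h.fderiv

/-- The operator `∂ᵢ` on `A U`. -/
def pd (U : TopologicalSpace.Opens (ι → ℝ)) (i : ι) : Module.End ℂ (A U) where
  toFun f := A.of U (partialDeriv i (ext U f)) (fun x => analyticAt_partialDeriv i (f.2 x))
  map_add' f g := by
    ext x
    have h : ext U (f + g : A U) =ᶠ[nhds (x : ι → ℝ)] ext U f + ext U g :=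
      ext_eventuallyEq U _ _ (fun y => by simp only [Pi.add_apply, ext_apply]; rfl) x
    change fderiv ℝ (ext U (f + g : A U)) x _ = fderiv ℝ (ext U f) x _ + fderiv ℝ (ext U g) x _
    rw [h.fderiv_eq, fderiv_add (f.2 x).differentiableAt (g.2 x).differentiableAt]
    rfl
  map_smul' c f := by
    ext x
    have h : ext U (c • f : A U) =ᶠ[nhds (x : ι → ℝ)] c • ext U f :=
      ext_eventuallyEq U _ _ (fun y => by simp only [Pi.smul_apply, ext_apply]; rfl) x
    change fderiv ℝ (ext U (c • f : A U)) x _ = c • fderiv ℝ (ext U f) x _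
    rw [h.fderiv_eq, fderiv_const_smul (f.2 x).differentiableAt]
    rfl

/-- Multiplication by an analytic function, as an operator on `A U`. -/
def mult (U : TopologicalSpace.Opens (ι → ℝ)) (f : A U) : Module.End ℂ (A U) :=
  LinearMap.mulLeft ℂ f

/-- The algebra of operators on `A U` generated by the multiplications and the partial
derivatives. -/
def diffOps (U : TopologicalSpace.Opens (ι → ℝ)) : Subalgebra ℂ (Module.End ℂ (A U)) :=
  Algebra.adjoin ℂ (Set.range (mult U) ∪ Set.range (pd U))

/-- The ring of differential operators on `U` with complex valued analytic coefficients. -/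
def D (U : TopologicalSpace.Opens (ι → ℝ)) : Type := diffOps U

instance (U : TopologicalSpace.Opens (ι → ℝ)) : Ring (D U) :=
  inferInstanceAs (Ring (diffOps U))

/-- The action of a differential operator on analytic functions. -/
def D.app {U : TopologicalSpace.Opens (ι → ℝ)} (P : D U) : Module.End ℂ (A U) := P.val

end Operators

/-! ### Parametrised analytic submanifolds of Euclidean space -/

/-- A patch of a `k`-dimensional real analytic (immersed) submanifold of `𝔼ⁿ`: an analytic
immersion `X` of an open set `U` of coordinates `(s¹, …, sᵏ)`. -/
structure Patch (k n : ℕ) where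
  U : TopologicalSpace.Opens (Fin k → ℝ)
  X : (Fin k → ℝ) → EuclideanSpace ℝ (Fin n)
  analytic : ∀ x ∈ U, AnalyticAt ℝ X x
  immersion : ∀ x ∈ U, Function.Injective (fderiv ℝ X x)

namespace Patch

variable {k n : ℕ}

/-- The part of the patch lying over a smaller open set of coordinates. -/
def restrict (S : Patch k n) (V : TopologicalSpace.Opens (Fin k → ℝ)) (hV : V ≤ S.U) :
    Patch k n :=
  ⟨V, S.X, fun x hx => S.analytic x (hV hx), fun x hx => S.immersion x (hV hx)⟩

/-- The induced metric `g_{αβ} = ⟪∂_α X, ∂_β X⟫`. -/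
def metric (S : Patch k n) (x : Fin k → ℝ) : Matrix (Fin k) (Fin k) ℝ :=
  Matrix.gram ℝ (fun α => partialDeriv α S.X x)

/-- The Beltrami-Laplace operator `g^{-1/2} ∂_α g^{1/2} g^{αβ} ∂_β` of the induced metric. -/
def beltramiLaplace (S : Patch k n) (ψ : A S.U) (x : S.U) : ℂ :=
  ((Real.sqrt (S.metric x).det : ℝ) : ℂ)⁻¹ * ∑ α, ∑ β,
    partialDeriv α (fun y =>
      ((Real.sqrt (S.metric y).det * (S.metric y)⁻¹ α β : ℝ) : ℂ) *
        partialDeriv β (ext S.U ψ) y) x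

end Patch

/-! ### Tubular neighbourhoods -/

/-- The map `(s, q) ↦ X(s) + ∑ q^a N_a(s)`. -/
def normalMap {k n d : ℕ} (X : (Fin k → ℝ) → EuclideanSpace ℝ (Fin n))
    (N : Fin d → (Fin k → ℝ) → EuclideanSpace ℝ (Fin n)) (u : Fin k ⊕ Fin d → ℝ) :
    EuclideanSpace ℝ (Fin n) :=
  X (u ∘ Sum.inl) + ∑ a, u (Sum.inr a) • N a (u ∘ Sum.inl)

/-- A tubular neighbourhood of a patch, in normal coordinates `u = (s, q)`: an analytic orthonormal
frame `N` of the normal bundle, and an open neighbourhood `T` of the zero section `q = 0` on which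
`Φ(s, q) = X(s) + ∑ q^a N_a(s)` is a local diffeomorphism to `𝔼ⁿ`. -/
structure Tube {k n : ℕ} (S : Patch k n) (d : ℕ) where
  N : Fin d → (Fin k → ℝ) → EuclideanSpace ℝ (Fin n)
  analytic : ∀ a, ∀ x ∈ S.U, AnalyticAt ℝ (N a) x
  orthonormal : ∀ x ∈ S.U, Orthonormal ℝ (fun a => N a x)
  normal : ∀ x ∈ S.U, ∀ a α, ⟪partialDeriv α S.X x, N a x⟫_ℝ = 0
  T : TopologicalSpace.Opens (Fin k ⊕ Fin d → ℝ)
  proj_mem : ∀ u ∈ T, u ∘ Sum.inl ∈ S.U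
  zero_mem : ∀ x ∈ S.U, Sum.elim x 0 ∈ T
  bijective : ∀ u ∈ T, Function.Bijective (fderiv ℝ (normalMap S.X N) u)

namespace Tube

variable {k n d : ℕ} {S : Patch k n} (t : Tube S d)

/-- The map from the tube to `𝔼ⁿ`. -/
def Φ : (Fin k ⊕ Fin d → ℝ) → EuclideanSpace ℝ (Fin n) := normalMap S.X t.N

lemma analyticAt_Φ (u : t.T) : AnalyticAt ℝ t.Φ u := by
  have hl : AnalyticAt ℝ (fun v : Fin k ⊕ Fin d → ℝ => v ∘ Sum.inl) u :=
    analyticAt_pi_iff.2 fun i =>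
      (ContinuousLinearMap.proj (R := ℝ) (φ := fun _ : Fin k ⊕ Fin d => ℝ)
        (Sum.inl i)).analyticAt _
  have hp : (u : Fin k ⊕ Fin d → ℝ) ∘ Sum.inl ∈ S.U := t.proj_mem u u.2
  refine ((S.analytic _ hp).comp_of_eq hl rfl).add ?_
  refine Finset.analyticAt_fun_sum _ fun a _ => ?_
  exact ((ContinuousLinearMap.proj (R := ℝ) (φ := fun _ : Fin k ⊕ Fin d => ℝ)
    (Sum.inr a)).analyticAt _).smul ((t.analytic a _ hp).comp_of_eq hl rfl)

/-- The determinant `g_T` of the metric induced on the tube from `𝔼ⁿ`. -/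
def detMetric (u : Fin k ⊕ Fin d → ℝ) : ℝ :=
  (Matrix.gram ℝ (fun μ => partialDeriv μ t.Φ u)).det

lemma detMetric_pos (u : t.T) : 0 < t.detMetric u := by
  refine (Matrix.posDef_gram_of_linearIndependent (𝕜 := ℝ) ?_).det_pos
  exact (Pi.linearIndependent_single_one (Fin k ⊕ Fin d) ℝ).map' _
    (LinearMap.ker_eq_bot.2 (t.bijective u u.2).1)

lemma analyticAt_detMetric (u : t.T) : AnalyticAt ℝ t.detMetric u := by
  unfold detMetric
  simp only [Matrix.det_apply]
  refine Finset.analyticAt_fun_sum _ fun σ _ => ?_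
  simp only [Units.smul_def, zsmul_eq_mul]
  refine analyticAt_const.mul ?_
  refine Finset.analyticAt_fun_prod _ fun i _ => ?_
  simp only [Matrix.gram_apply]
  exact ((innerSL ℝ).analyticAt_bilinear _).comp₂
    (analyticAt_partialDeriv _ (t.analyticAt_Φ u)) (analyticAt_partialDeriv _ (t.analyticAt_Φ u))

lemma analyticAt_rpow (r : ℝ) (u : t.T) :
    AnalyticAt ℝ (fun v => ((t.detMetric v ^ r : ℝ) : ℂ)) u := by
  have hp := t.detMetric_pos u
  have h : AnalyticAt ℝ (fun v => Real.exp (Real.log (t.detMetric v) * r)) u :=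
    (((analyticAt_log hp).comp_of_eq (t.analyticAt_detMetric u) rfl).mul analyticAt_const).rexp'
  refine ((Complex.ofRealCLM.analyticAt _).comp h).congr ?_
  filter_upwards [(t.analyticAt_detMetric u).continuousAt.eventually (lt_mem_nhds hp)] with v hv
  simp [Real.rpow_def_of_pos hv]

/-- The invertible function `g_T^{1/4}`, that is, the half form `√w_T` in coordinates. -/
def halfForm : (A t.T)ˣ where
  val := A.of t.T _ (t.analyticAt_rpow (1 / 4))
  inv := A.of t.T _ (t.analyticAt_rpow (-(1 / 4)))
  val_inv := by
    ext u
    change ((t.detMetric u ^ (1 / 4 : ℝ) : ℝ) : ℂ) * ((t.detMetric u ^ (-(1 / 4) : ℝ) : ℝ) : ℂ) = 1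
    rw [← Complex.ofReal_mul, ← Real.rpow_add (t.detMetric_pos u)]
    simp
  inv_val := by
    ext u
    change ((t.detMetric u ^ (-(1 / 4) : ℝ) : ℝ) : ℂ) * ((t.detMetric u ^ (1 / 4 : ℝ) : ℝ) : ℂ) = 1
    rw [← Complex.ofReal_mul, ← Real.rpow_add (t.detMetric_pos u)]
    simp

/-- The anti-self-adjoint connection `∇_a = g_T^{-1/4} ∂_{q^a} g_T^{1/4}` in a normal direction. -/
def nabla (a : Fin d) : Module.End ℂ (A t.T) :=
  mult t.T ↑t.halfForm⁻¹ * pd t.T (Sum.inr a) * mult t.T ↑t.halfForm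

/-- The monomial `∇^γ` in the (commuting) normal connections. -/
def nablaPow (γ : Fin d →₀ ℕ) : Module.End ℂ (A t.T) :=
  (List.ofFn fun a => t.nabla a ^ γ a).prod

/-- Restriction `f ↦ f|_S` of analytic functions from the tube to the zero section. -/
def toS : A t.T →ₗ[ℂ] A S.U where
  toFun f := A.of S.U (fun x => ext t.T f (Sum.elim x 0)) fun x => by
    refine AnalyticAt.comp_of_eq (f.2 ⟨_, t.zero_mem x x.2⟩) ?_ rfl
    refine analyticAt_pi_iff.2 fun i => ?_
    cases i with
    | inl i => exact (ContinuousLinearMap.proj (R := ℝ) (φ := fun _ : Fin k => ℝ) i).analyticAt _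
    | inr a => exact analyticAt_const
  map_add' f g := by
    ext x
    have h := t.zero_mem x x.2
    exact (ext_apply t.T (f + g : A t.T) ⟨_, h⟩).trans
      (congrArg₂ (· + ·) (ext_apply t.T f ⟨_, h⟩).symm (ext_apply t.T g ⟨_, h⟩).symm)
  map_smul' c f := by
    ext x
    have h := t.zero_mem x x.2
    exact (ext_apply t.T (c • f : A t.T) ⟨_, h⟩).trans
      (congrArg (c * ·) (ext_apply t.T f ⟨_, h⟩).symm)

/-- The pullback `F ↦ F ∘ Φ` of functions from `𝔼ⁿ` to the tube. -/
def pullback (F : EuclideanSpace ℝ (Fin n) → ℂ) (hF : ∀ y, AnalyticAt ℝ F y) : A t.T :=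
  A.of t.T (F ∘ t.Φ) fun u => (hF _).comp (t.analyticAt_Φ u)

/-- `P` is the generator `-Δ_T` of the inverse image on the tube of the Schrödinger system
`D / D (-Δ)` of `𝔼ⁿ`: the differential operator on the tube that corresponds to the Euclidean
`-Δ` under the local diffeomorphism `Φ`. -/
def IsSchrodinger (P : D t.T) : Prop :=
  ∀ (F : EuclideanSpace ℝ (Fin n) → ℂ) (hF : ∀ y, AnalyticAt ℝ F y) (u : t.T),
    P.app (t.pullback F hF) u = -(Δ F) (t.Φ u)

/-! ### The submanifold Schrödinger system -/

/-- The ring `C_S ⊗ D_T` of operators in standard form with coefficients frozen at `q = 0`: an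
element is a finite sum `∑ R_γ ∇^γ` with `R_γ` a differential operator on `S`, and `∇_1, …, ∇_d`
are commuting variables, which commute with the differential operators on `S`. -/
abbrev DST (S : Patch k n) (d : ℕ) : Type := AddMonoidAlgebra (D S.U) (Fin d →₀ ℕ)

/-- The standard form with the `∇`'s to the right: `R = ∑ R_γ ∇^γ` is the restriction to `q = 0` of
the operator `P` on the tube, that is, `(P f)|_S = ∑ R_γ ((∇^γ f)|_S)` for all `f`. -/
def IsRestriction (P : D t.T) (R : DST S d) : Prop :=
  ∀ f : A t.T, t.toS (P.app f) =
    R.coeff.sum fun γ Q => Q.app (t.toS (t.nablaPow γ f))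

/-- The left ideal generated by the restriction to `q = 0` of the Schrödinger operator `-Δ_T`. -/
def schrodingerIdeal : Submodule (DST S d) (DST S d) :=
  Submodule.span (DST S d) {R | ∃ P : D t.T, t.IsSchrodinger P ∧ t.IsRestriction P R}

/-- The inverse image on `S` of the Schrödinger system of the tube. -/
abbrev SystemST (t : Tube S d) : Type := (DST S d) ⧸ t.schrodingerIdeal

/-- The variable `∇_a` in `C_S ⊗ D_T`. -/
def var (a : Fin d) : DST S d := AddMonoidAlgebra.single (Finsupp.single a 1) 1

lemma var_comm (a : Fin d) (R : DST S d) : R * var a = var a * R := by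
  induction R using AddMonoidAlgebra.induction_linear with
  | zero => simp
  | add f g hf hg => rw [add_mul, mul_add, hf, hg]
  | single m r =>
    simp only [var, AddMonoidAlgebra.single_mul_single, mul_one, one_mul, add_comm]

/-- The endomorphism `R ↦ R ∇_a` of the Schrödinger system on `S`. -/
def eta (a : Fin d) : t.SystemST →ₗ[(DST S d)] t.SystemST :=
  Submodule.mapQ t.schrodingerIdeal t.schrodingerIdeal
    (LinearMap.toSpanSingleton (DST S d) (DST S d) (var a)) fun R hR => by
      simpa [var_comm a R] using t.schrodingerIdeal.smul_mem (var (S := S) a) hR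

/-- The map `(R_a)_a ↦ ∑ R_a ∇_a` from the `d`-fold sum of the Schrödinger system. -/
def etaConf : (Fin d → t.SystemST) →ₗ[(DST S d)] t.SystemST :=
  ∑ a, (t.eta a).comp (LinearMap.proj a)

/-- The submanifold Schrödinger system: the cokernel of `etaConf`. -/
def SubmanifoldSystem : Type := t.SystemST ⧸ LinearMap.range t.etaConf

instance : AddCommGroup t.SubmanifoldSystem :=
  inferInstanceAs (AddCommGroup (t.SystemST ⧸ LinearMap.range t.etaConf))

instance : Module (DST S d) t.SubmanifoldSystem :=
  inferInstanceAs (Module (DST S d) (t.SystemST ⧸ LinearMap.range t.etaConf))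

/-- The submanifold Schrödinger system as a module over the differential operators on `S`. -/
instance : Module (D S.U) t.SubmanifoldSystem :=
  Module.compHom _ (AddMonoidAlgebra.singleZeroRingHom : D S.U →+* DST S d)

/-- The class of `1`, the canonical generator of the submanifold Schrödinger system. -/
def generator : t.SubmanifoldSystem :=
  (LinearMap.range t.etaConf).mkQ (t.schrodingerIdeal.mkQ 1)

/-- `L` is the submanifold Schrödinger operator `Δ_{S ↪ 𝔼ⁿ}`: it differs from the Beltrami-Laplace
operator by a function, and the sequence `0 → D_S → D_S → SubmanifoldSystem → 0`, with first map
`P ↦ P (-L)` and second map the canonical `P ↦ P • generator`, is exact. -/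
structure IsSubmanifoldSchrodingerOperator (L : D S.U) : Prop where
  principal : ∃ f : A S.U, ∀ (ψ : A S.U) (x : S.U),
    L.app ψ x = S.beltramiLaplace ψ x + f x * ψ x
  injective : Function.Injective (LinearMap.toSpanSingleton (D S.U) (D S.U) (-L))
  exact : Function.Exact (LinearMap.toSpanSingleton (D S.U) (D S.U) (-L))
    (LinearMap.toSpanSingleton (D S.U) t.SubmanifoldSystem t.generator)
  surjective : Function.Surjective
    (LinearMap.toSpanSingleton (D S.U) t.SubmanifoldSystem t.generator)

end Tube

/-! ### Curvatures of curves and surfaces in `𝔼³` -/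

/-- The vector product in `𝔼³`. -/
def cross (v w : EuclideanSpace ℝ (Fin 3)) : EuclideanSpace ℝ (Fin 3) :=
  WithLp.toLp 2 (crossProduct (WithLp.ofLp v) (WithLp.ofLp w))

/-- The Frenet-Serret curvature of a curve parametrised by arclength. -/
def curvature (c : ℝ → EuclideanSpace ℝ (Fin 3)) (s : ℝ) : ℝ := ‖deriv (deriv c) s‖

/-- The principal normal `c'' / κ`. -/
def principalNormal (c : ℝ → EuclideanSpace ℝ (Fin 3)) (s : ℝ) : EuclideanSpace ℝ (Fin 3) :=
  (curvature c s)⁻¹ • deriv (deriv c) s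

/-- The binormal. -/
def binormal (c : ℝ → EuclideanSpace ℝ (Fin 3)) (s : ℝ) : EuclideanSpace ℝ (Fin 3) :=
  cross (deriv c s) (principalNormal c s)

/-- The Frenet-Serret torsion: the binormal component of the derivative of the principal normal. -/
def torsion (c : ℝ → EuclideanSpace ℝ (Fin 3)) (s : ℝ) : ℝ :=
  ⟪deriv (principalNormal c) s, binormal c s⟫_ℝ

/-- The complex curvature `κ exp(√-1 ∫ τ ds)`, with base point `s₀` of the integral. It is zero
where `κ` is. -/
def complexCurvature (c : ℝ → EuclideanSpace ℝ (Fin 3)) (s₀ s : ℝ) : ℂ :=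
  (curvature c s : ℂ) * Complex.exp (Complex.I * ((∫ r in s₀..s, torsion c r : ℝ) : ℂ))

/-- The patch of a curve parametrised by arclength. -/
def curvePatch (I : TopologicalSpace.Opens ℝ) (c : ℝ → EuclideanSpace ℝ (Fin 3))
    (hc : ∀ s ∈ I, AnalyticAt ℝ c s) (hs : ∀ s ∈ I, ‖deriv c s‖ = 1) : Patch 1 3 where
  U := ⟨(fun u : Fin 1 → ℝ => u 0) ⁻¹' I, I.isOpen.preimage (continuous_apply 0)⟩
  X := fun u => c (u 0)
  analytic x hx := (hc _ hx).comp_of_eq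
    ((ContinuousLinearMap.proj (R := ℝ) (φ := fun _ : Fin 1 => ℝ) 0).analyticAt x) rfl
  immersion x hx := by
    have h1 : HasDerivAt c (deriv c (x 0)) (x 0) := (hc _ hx).differentiableAt.hasDerivAt
    have h2 := HasFDerivAt.comp (f := fun u : Fin 1 → ℝ => u 0) x h1.hasFDerivAt
      (ContinuousLinearMap.proj (R := ℝ) (φ := fun _ : Fin 1 => ℝ) 0).hasFDerivAt
    have h3 : deriv c (x 0) ≠ 0 := fun h => by
      have := hs _ hx
      simp [h] at this
    have h4 : fderiv ℝ (fun u : Fin 1 → ℝ => c (u 0)) x = _ := h2.fderiv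
    rw [h4]
    intro v w hvw
    ext i
    fin_cases i
    exact smul_left_injective ℝ h3 (by simpa using hvw)

namespace Patch

/-- The unit normal of a surface. -/
def unitNormal (S : Patch 2 3) (x : Fin 2 → ℝ) : EuclideanSpace ℝ (Fin 3) :=
  ‖cross (partialDeriv 0 S.X x) (partialDeriv 1 S.X x)‖⁻¹ •
    cross (partialDeriv 0 S.X x) (partialDeriv 1 S.X x)

/-- The matrix of the Weingarten map: the inverse of the first fundamental form times the second. -/
def weingarten (S : Patch 2 3) (x : Fin 2 → ℝ) : Matrix (Fin 2) (Fin 2) ℝ :=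
  (S.metric x)⁻¹ * Matrix.of fun α β =>
    ⟪partialDeriv α (partialDeriv β S.X) x, S.unitNormal x⟫_ℝ

/-- The mean curvature. -/
def meanCurvature (S : Patch 2 3) (x : Fin 2 → ℝ) : ℝ := (S.weingarten x).trace / 2

/-- The Gauss curvature. -/
def gaussCurvature (S : Patch 2 3) (x : Fin 2 → ℝ) : ℝ := (S.weingarten x).det

/-- `k₁`, `k₂` are the principal curvatures: the eigenvalues of the Weingarten map, with
multiplicity. -/
def IsPrincipalCurvatures (S : Patch 2 3) (x : Fin 2 → ℝ) (k₁ k₂ : ℝ) : Prop :=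
  (S.weingarten x).charpoly = (Polynomial.X - Polynomial.C k₁) * (Polynomial.X - Polynomial.C k₂)

end Patch

end SubmanifoldSchrodinger

end

/-!
Let `w = g_T^{1/4}`, `g` the first fundamental form of `S`, `h_a = ⟪∂_α ∂_β X, N_a⟫` the second
fundamental forms, and `H_a = tr (g⁻¹ h_a)`. Everything follows from one computation along the zero
section,
`(Δ_T f)|_S = Δ_S (f|_S) + ∑ (∂_a² f - H_a ∂_a f)|_S = Δ_S (f|_S) + ∑ (∇_a² f)|_S - (∑ V_a) f|_S`,
where `V_a = w⁻¹ ∂_a² w` on `S`.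

The operator `Δ_T` is written as `∑ E_m²`, where the `E_m` are the lifts of the Euclidean partial
derivatives (`Tube.euclid`); its first order part is determined by the fact that the Cartesian
coordinates are harmonic (`Tube.sum_driftT_mul_gramT`), and the tangential part so obtained is the
Beltrami-Laplace operator (`Patch.beltramiLaplace_eq`). This gives the first equality
(`Tube.toSHom_sum_euclid_euclid`). The second holds because `det g · g_T = det (g - ∑ q^a h_a)²`
(`Tube.extend_det_mul_halfForm`), so that `∂_a w = -H_a w / 2` on `S`; the second derivatives
of the same identity yield `4 V_a = 2 ∂_a² det (g - ∑ q^a h_a) / det g - H_a²`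
(`Tube.det_mul_potential`).

Thus `-Δ_T|_S = -L - ∑ ∇_a²` with `L = Δ_S - ∑ V_a`. No other standard form matters for the ideal:
differential operators depend on finite jets only, and all jets are those of polynomials in the
Cartesian coordinates, so that `-Δ_T` is the only Schrödinger operator of the tube
(`Tube.IsSchrodinger.eq`); and testing on the functions that are annihilated by all `∇_a` determines
the part of a restriction without `∇`'s (`Tube.IsRestriction.coeff_zero_app`). Setting the central
variables `∇_a` to zero therefore identifies the submanifold Schrödinger system with `D_S / D_S L`
(`Tube.smul_generator_eq_zero_iff`). Injectivity of `P ↦ P L` and the uniqueness of `L`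
hold because the iterated commutators of `P L` with a coordinate do not all vanish unless
`P = 0`: the top one is a nonzero multiple of the top one of `P` times the principal symbol of `L`
(`eq_zero_of_ad_mul_eq_zero`).

For an arclength curve `det (g - ∑ q^a h_a) = 1 - ∑ q^a ⟪c'', N_a⟫` is affine in `q`, whence
`∑ V_a = -κ² / 4`; for a surface the determinant is `det g · (1 ∓ 2 H q + K q²)`, whence
`V = K - H²`.
-/

set_option linter.unusedSectionVars false

noncomputable section

namespace SubmanifoldSchrodinger

open scoped Matrix

/-! ### Jets along commuting derivations -/

section Jets

variable {R ι : Type*} [CommRing R] [Algebra ℂ R]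

/-- The elements that vanish to order `M` at the point `φ`: all derivatives of order less than `M`
along the derivations `E i` are zero there. -/
def vanishing (φ : R →ₐ[ℂ] ℂ) (E : ι → Derivation ℂ R R) : ℕ → Submodule ℂ R
  | 0 => ⊤
  | M + 1 => LinearMap.ker φ.toLinearMap ⊓ ⨅ i, (vanishing φ E M).comap (E i).toLinearMap

variable {φ : R →ₐ[ℂ] ℂ} {E : ι → Derivation ℂ R R}

lemma mem_vanishing_succ {M : ℕ} {f : R} :
    f ∈ vanishing φ E (M + 1) ↔ φ f = 0 ∧ ∀ i, E i f ∈ vanishing φ E M := by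
  simp [vanishing]

lemma vanishing_succ_le (M : ℕ) : vanishing φ E (M + 1) ≤ vanishing φ E M := by
  induction M with
  | zero => exact le_top
  | succ M ih =>
    intro f hf
    rw [mem_vanishing_succ] at hf ⊢
    exact ⟨hf.1, fun i => ih (hf.2 i)⟩

lemma mul_mem_vanishing {M : ℕ} (h : R) {f : R} (hf : f ∈ vanishing φ E M) :
    h * f ∈ vanishing φ E M := by
  induction M generalizing h f with
  | zero => trivial
  | succ M ih =>
    have hf' := mem_vanishing_succ.1 hf
    refine mem_vanishing_succ.2 ⟨by rw [map_mul, hf'.1, mul_zero], fun i => ?_⟩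
    rw [Derivation.leibniz, smul_eq_mul, smul_eq_mul]
    refine add_mem (ih _ (hf'.2 i)) ?_
    rw [mul_comm]
    exact ih _ (vanishing_succ_le M hf)

lemma mul_mem_vanishing_succ {M : ℕ} {h f : R} (hh : φ h = 0) (hf : f ∈ vanishing φ E M) :
    h * f ∈ vanishing φ E (M + 1) := by
  induction M generalizing f with
  | zero => exact mem_vanishing_succ.2 ⟨by rw [map_mul, hh, zero_mul], fun _ => trivial⟩
  | succ M ih =>
    refine mem_vanishing_succ.2 ⟨by rw [map_mul, hh, zero_mul], fun i => ?_⟩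
    rw [Derivation.leibniz, smul_eq_mul, smul_eq_mul]
    refine add_mem (ih ((mem_vanishing_succ.1 hf).2 i)) ?_
    rw [mul_comm]
    exact mul_mem_vanishing _ hf

variable [Fintype ι] [DecidableEq ι] {y : ι → R}

/-- Euler's identity for homogeneous functions, modulo terms of higher order. -/
lemma euler_mem_vanishing (hE : ∀ i j f, E i (E j f) = E j (E i f))
    (hy : ∀ i j, E i (y j) = if i = j then 1 else 0) {M : ℕ} {f : R}
    (hf : f ∈ vanishing φ E M) :
    (M : ℂ) • f - ∑ j, (y j - algebraMap ℂ R (φ (y j))) * E j f ∈ vanishing φ E (M + 1) := by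
  have h0 : ∀ g : R, φ (∑ j, (y j - algebraMap ℂ R (φ (y j))) * E j g) = 0 := fun g => by
    simp
  induction M generalizing f with
  | zero =>
    refine mem_vanishing_succ.2 ⟨?_, fun _ => trivial⟩
    rw [map_sub, h0]
    simp
  | succ M ih =>
    have hf' := mem_vanishing_succ.1 hf
    refine mem_vanishing_succ.2 ⟨?_, fun i => ?_⟩
    · rw [map_sub, h0, map_smul, hf'.1, smul_zero, sub_zero]
    · convert ih (hf'.2 i) using 1
      have h1 : ∀ j, E i ((y j - algebraMap ℂ R (φ (y j))) * E j f) =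
          (y j - algebraMap ℂ R (φ (y j))) * E j (E i f) + if i = j then E i f else 0 := by
        intro j
        rw [Derivation.leibniz, map_sub, Derivation.map_algebraMap, hy, hE i j]
        split_ifs with h <;> simp [h]
      rw [map_sub, map_sum, Finset.sum_congr rfl fun j _ => h1 j, Finset.sum_add_distrib,
        Finset.sum_ite_eq]
      simp only [Finset.mem_univ, if_true, Derivation.map_smul]
      push_cast
      rw [add_smul, one_smul]
      ring

/-- Taylor's formula at the point `φ`, with the polynomials in the coordinates `y`. -/
lemma exists_sub_mem_vanishing (hE : ∀ i j f, E i (E j f) = E j (E i f))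
    (hy : ∀ i j, E i (y j) = if i = j then 1 else 0) (M : ℕ) (f : R) :
    ∃ p ∈ Algebra.adjoin ℂ (Set.range y), f - p ∈ vanishing φ E M := by
  induction M generalizing f with
  | zero => exact ⟨0, zero_mem _, trivial⟩
  | succ M ih =>
    rcases Nat.eq_zero_or_pos M with rfl | hM
    · exact ⟨algebraMap ℂ R (φ f), Subalgebra.algebraMap_mem _ _,
        mem_vanishing_succ.2 ⟨by simp, fun _ => trivial⟩⟩
    obtain ⟨p, hp, hfp⟩ := ih f
    choose r hr hrE using fun j => ih (E j (f - p))
    have hM' : (M : ℂ) ≠ 0 := by exact_mod_cast hM.ne'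
    set c : ι → R := fun j => y j - algebraMap ℂ R (φ (y j)) with hc
    have hcφ : ∀ j, φ (c j) = 0 := fun j => by simp [hc]
    refine ⟨p + (M : ℂ)⁻¹ • ∑ j, c j * r j, add_mem hp (Subalgebra.smul_mem _ (sum_mem
      fun j _ => mul_mem (sub_mem (Algebra.subset_adjoin (Set.mem_range_self j))
        (Subalgebra.algebraMap_mem _ _)) (hr j)) _), ?_⟩
    have h1 := (vanishing φ E (M + 1)).smul_mem (M : ℂ)⁻¹ (add_mem (euler_mem_vanishing hE hy hfp)
      (sum_mem fun j (_ : j ∈ Finset.univ) => mul_mem_vanishing_succ (hcφ j) (hrE j)))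
    convert h1 using 1
    simp only [mul_sub, Finset.sum_sub_distrib]
    rw [sub_add_sub_cancel, smul_sub, smul_smul, inv_mul_cancel₀ hM', one_smul, sub_sub]

end Jets

/-! ### Iterated commutators -/

section Commutators

variable {B : Type*} [Ring B]

/-- The inner derivation `P ↦ P y - y P`. -/
def ad (y : B) : B →+ B := AddMonoidHom.mulRight y - AddMonoidHom.mulLeft y

lemma ad_apply (y P : B) : ad y P = P * y - y * P := rfl

lemma ad_mul (y P Q : B) : ad y (P * Q) = ad y P * Q + P * ad y Q := by
  simp only [ad_apply]; noncomm_ring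

lemma exists_iterate_ad_mul_eq_zero {y : B} (m n : ℕ) {P Q : B} (hP : (ad y)^[m] P = 0)
    (hQ : (ad y)^[n] Q = 0) : ∃ l, (ad y)^[l] (P * Q) = 0 := by
  have key : ∀ l m n : ℕ, m + n ≤ l → ∀ P Q : B, (ad y)^[m] P = 0 → (ad y)^[n] Q = 0 →
      (ad y)^[l] (P * Q) = 0 := by
    intro l
    induction l with
    | zero =>
      intro m n h P Q hP _
      obtain rfl : m = 0 := by omega
      rw [Function.iterate_zero, id] at hP
      simp [hP]
    | succ l ih =>
      intro m n h P Q hP hQ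
      rcases m with - | m
      · rw [Function.iterate_zero, id] at hP
        rw [hP, zero_mul, iterate_map_zero]
      rcases n with - | n
      · rw [Function.iterate_zero, id] at hQ
        rw [hQ, mul_zero, iterate_map_zero]
      rw [Function.iterate_succ_apply, ad_mul, iterate_map_add,
        ih m (n + 1) (by omega) _ _ (by rwa [Function.iterate_succ_apply] at hP) hQ,
        ih (m + 1) n (by omega) _ _ hP (by rwa [Function.iterate_succ_apply] at hQ), add_zero]
  exact ⟨_, key _ m n le_rfl P Q hP hQ⟩

lemma iterate_ad_mul_of_order_two {y L c : B} (hc : ad y (ad y L) = c) (hc' : ad y c = 0) (P : B)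
    (n : ℕ) :
    (ad y)^[n + 2] (P * L) = (ad y)^[n + 2] P * L + (n + 2) • ((ad y)^[n + 1] P * ad y L) +
      (n + 2).choose 2 • ((ad y)^[n] P * c) := by
  induction n with
  | zero =>
    simp only [zero_add, Function.iterate_succ_apply', Function.iterate_zero, id, ad_mul,
      map_add, hc, Nat.choose_self, one_smul, two_smul]
    abel
  | succ n ih =>
    have h : (n + 1 + 2).choose 2 = (n + 2) + (n + 2).choose 2 := by
      rw [show n + 1 + 2 = (n + 2) + 1 by ring, Nat.choose_succ_succ' (n + 2) 1, Nat.choose_one_right]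
    rw [show n + 1 + 2 = (n + 2) + 1 by ring, Function.iterate_succ_apply', ih]
    simp only [map_add, map_nsmul, ad_mul, hc, hc', mul_zero, add_zero,
      ← Function.iterate_succ_apply' (ad y)]
    simp only [h, add_assoc, Nat.reduceAdd]
    generalize (ad y)^[n + 3] P = p₃, (ad y)^[n + 2] P = p₂, (ad y)^[n + 1] P = p₁,
      (n + 2).choose 2 = b
    simp only [add_smul, smul_add]
    abel

/-- If `L` has order two, with a symbol `c` at `y` that can be cancelled, then a multiple `P L` of
`L` commutes with `y` only for `P = 0`, as its top commutator with `y` is a multiple of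
the top commutator of `P` times `c`. -/
lemma eq_zero_of_ad_mul_eq_zero [IsAddTorsionFree B] {y L c : B} (hc : ad y (ad y L) = c)
    (hc' : ad y c = 0) (hcancel : ∀ Q : B, Q * c = 0 → Q = 0) {P : B} {n : ℕ}
    (hP : (ad y)^[n] P = 0) (h : ad y (P * L) = 0) : P = 0 := by
  induction n with
  | zero => exact hP
  | succ n ih =>
    refine ih (hcancel _ ?_)
    have h1 := iterate_ad_mul_of_order_two hc hc' P n
    rw [Function.iterate_succ_apply, h, iterate_map_zero, Function.iterate_succ_apply', hP, map_zero,
      zero_mul, zero_mul, smul_zero, zero_add, zero_add] at h1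
    exact (smul_eq_zero_iff_right (Nat.choose_pos (by omega)).ne').1 h1.symm

end Commutators

/-! ### Derivations of determinants and commuting frames -/

section Frames

variable {R : Type*} [CommRing R] [Algebra ℂ R]

lemma derivation_prod {ι : Type*} [Fintype ι] [DecidableEq ι] (δ : Derivation ℂ R R)
    (s : Finset ι) (f : ι → R) : δ (∏ i ∈ s, f i) =
      ∑ i ∈ s, ∏ j ∈ s, if j = i then δ (f j) else f j := by
  induction s using Finset.induction_on with
  | empty => simp
  | insert a s ha ih =>
    rw [Finset.prod_insert ha, Derivation.leibniz, ih, Finset.sum_insert ha, Finset.prod_insert ha,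
      smul_eq_mul, smul_eq_mul, Finset.mul_sum, add_comm]
    congr 1
    · rw [if_pos rfl, mul_comm]
      congr 1
      exact Finset.prod_congr rfl fun j hj => by rw [if_neg (by rintro rfl; exact ha hj)]
    · refine Finset.sum_congr rfl fun i hi => ?_
      rw [Finset.prod_insert ha, if_neg (by rintro rfl; exact ha hi)]

/-- Jacobi's formula for the derivative of a determinant. -/
lemma derivation_det {ι : Type*} [Fintype ι] [DecidableEq ι] (δ : Derivation ℂ R R)
    (M : Matrix ι ι R) : δ M.det = ∑ i, ∑ j, M.adjugate i j * δ (M j i) := by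
  have h : ∀ i, ∑ j, M.adjugate i j * δ (M j i) =
      (M.updateCol i fun j => δ (M j i)).det := by
    intro i
    rw [← Matrix.cramer_apply, Matrix.cramer_eq_adjugate_mulVec]
    rfl
  simp only [h, Matrix.det_apply, Units.smul_def, map_sum, map_zsmul]
  rw [Finset.sum_comm]
  refine Finset.sum_congr rfl fun σ _ => ?_
  rw [derivation_prod, Finset.smul_sum]
  refine Finset.sum_congr rfl fun i _ => ?_
  congr 1
  refine Finset.prod_congr rfl fun j _ => ?_
  simp only [Matrix.updateCol_apply]
  split_ifs with h <;> simp [h]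

variable {I K : Type*} [Fintype I] [Fintype K] [DecidableEq I] [DecidableEq K]
  {e : Matrix K I R} {J : Matrix I K R} {δ : I → Derivation ℂ R R} {y : K → R}

/-- The frame of derivations `∑ i, e m i • δ i`. -/
def frame (e : Matrix K I R) (δ : I → Derivation ℂ R R) (m : K) : Derivation ℂ R R :=
  ∑ i, e m i • δ i

lemma frame_apply (m : K) (f : R) : frame e δ m f = ∑ i, e m i * δ i f := by
  have h := congrFun (map_sum (Derivation.coeFnAddMonoidHom (R := ℂ) (A := R) (M := R))
    (fun i => e m i • δ i) Finset.univ) f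
  rw [Finset.sum_apply] at h
  exact h

lemma frame_coordinate (hJ : ∀ i m, J i m = δ i (y m)) (h : e * J = 1) (l m : K) :
    frame e δ l (y m) = if l = m then 1 else 0 := by
  simp only [frame_apply, ← hJ]
  rw [← Matrix.mul_apply, h, Matrix.one_apply]

lemma sum_mul_frame (h : J * e = 1) (i : I) (f : R) : ∑ m, J i m * frame e δ m f = δ i f := by
  simp only [frame_apply, Finset.mul_sum]
  rw [Finset.sum_comm]
  simp only [← mul_assoc, ← Finset.sum_mul]
  simp only [← Matrix.mul_apply, h, Matrix.one_apply, ite_mul, one_mul, zero_mul,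
    Finset.sum_ite_eq, Finset.mem_univ, if_true]

/-- A frame for which the `y` are coordinates consists of commuting vector fields: the coefficients
of a commutator are determined by its values on the `y`, which are zero. -/
lemma frame_comm (hδ : ∀ i j f, δ i (δ j f) = δ j (δ i f)) (hJ : ∀ i m, J i m = δ i (y m))
    (h : e * J = 1) (h' : J * e = 1) (l m : K) (f : R) :
    frame e δ l (frame e δ m f) = frame e δ m (frame e δ l f) := by
  set c : I → R := fun i => frame e δ l (e m i) - frame e δ m (e l i) with hc
  have key : ∀ g, frame e δ l (frame e δ m g) - frame e δ m (frame e δ l g) =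
      ∑ i, c i * δ i g := by
    intro g
    have h1 : ∀ l m : K, frame e δ l (frame e δ m g) =
        ∑ i, frame e δ l (e m i) * δ i g + ∑ i, ∑ j, e m i * e l j * δ j (δ i g) := by
      intro l m
      rw [frame_apply (m := m), map_sum, ← Finset.sum_add_distrib]
      refine Finset.sum_congr rfl fun i _ => ?_
      rw [Derivation.leibniz, smul_eq_mul, smul_eq_mul, frame_apply (m := l) (f := δ i g),
        Finset.mul_sum]
      simp only [mul_assoc]
      ring
    rw [h1, h1, Finset.sum_comm (f := fun i j => e m i * e l j * δ j (δ i g))]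
    simp only [hc, sub_mul, Finset.sum_sub_distrib]
    have h2 : ∀ i j, e m j * e l i * δ i (δ j g) = e l i * e m j * δ j (δ i g) := fun i j => by
      rw [hδ i j]; ring
    simp only [h2]
    ring
  have hcJ : c ᵥ* J = 0 := by
    ext n
    have h3 := key (y n)
    rw [frame_coordinate hJ h, frame_coordinate hJ h] at h3
    have h4 : ∀ (l : K) (p : Prop) [Decidable p], frame e δ l (if p then 1 else 0) = 0 := by
      intro l p _
      split_ifs
      · exact Derivation.map_one_eq_zero _
      · exact map_zero _
    rw [h4, h4, sub_zero] at h3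
    simp only [← hJ] at h3
    exact h3.symm
  have hc0 : c = 0 := by
    have := congrArg (· ᵥ* e) hcJ
    simpa [Matrix.vecMul_vecMul, h'] using this
  have := key f
  rw [hc0] at this
  simpa [sub_eq_zero] using this

end Frames

/-! ### Calculus of analytic functions on coordinate space -/

section Functions

variable {ι : Type} [Fintype ι] {U : TopologicalSpace.Opens (ι → ℝ)}

/-- Evaluation of analytic functions at a point. -/
def A.eval (x : U) : A U →ₐ[ℂ] ℂ where
  toFun f := f x
  map_one' := rfl
  map_mul' _ _ := rfl
  map_zero' := rfl
  map_add' _ _ := rfl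
  commutes' _ := rfl

lemma A.eval_apply (x : U) (f : A U) : A.eval x f = f x := rfl

lemma A.ext_eval {f g : A U} (h : ∀ x : U, A.eval x f = A.eval x g) : f = g := A.ext h

@[simp] lemma A.eval_of (x : U) (F : (ι → ℝ) → ℂ) (hF : ∀ x : U, AnalyticAt ℝ F x) :
    A.eval x (A.of U F hF) = F x := rfl

lemma A.isUnit {f : A U} (h : ∀ x, f x ≠ 0) : IsUnit f := by
  have hinv : ∀ x : U, AnalyticAt ℝ (fun y => (SubmanifoldSchrodinger.ext U f y)⁻¹) x :=
    fun x => (f.2 x).inv (by rw [ext_apply]; exact h x)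
  refine IsUnit.of_mul_eq_one (A.of U _ hinv) (A.ext fun x => ?_)
  change f x * (SubmanifoldSchrodinger.ext U f x)⁻¹ = 1
  rw [ext_apply, mul_inv_cancel₀ (h x)]

lemma analyticAt_ofReal {F : (ι → ℝ) → ℝ} {x : ι → ℝ} (hF : AnalyticAt ℝ F x) :
    AnalyticAt ℝ (fun y => (F y : ℂ)) x :=
  (Complex.ofRealCLM.analyticAt _).comp hF

lemma analyticAt_apply {n : ℕ} {X : (ι → ℝ) → EuclideanSpace ℝ (Fin n)} {x : ι → ℝ}
    (hX : AnalyticAt ℝ X x) (m : Fin n) : AnalyticAt ℝ (fun y => X y m) x :=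
  ((EuclideanSpace.proj m : EuclideanSpace ℝ (Fin n) →L[ℝ] ℝ).analyticAt _).comp hX

lemma analyticAt_coord (i : ι) (x : ι → ℝ) : AnalyticAt ℝ (fun y : ι → ℝ => y i) x :=
  (ContinuousLinearMap.proj (R := ℝ) (φ := fun _ : ι => ℝ) i).analyticAt _

variable [DecidableEq ι]

lemma pd_apply (i : ι) (f : A U) (x : U) : pd U i f x = partialDeriv i (ext U f) x := rfl

lemma partialDeriv_congr {F : Type} [NormedAddCommGroup F] [NormedSpace ℝ F] {i : ι}
    {f g : (ι → ℝ) → F} {x : ι → ℝ} (h : f =ᶠ[nhds x] g) :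
    partialDeriv i f x = partialDeriv i g x := by
  rw [partialDeriv, partialDeriv, h.fderiv_eq]

lemma pd_of (i : ι) (F : (ι → ℝ) → ℂ) (hF : ∀ x : U, AnalyticAt ℝ F x) :
    pd U i (A.of U F hF) =
      A.of U (partialDeriv i F) fun x => analyticAt_partialDeriv i (hF x) :=
  A.ext fun x => partialDeriv_congr (ext_eventuallyEq U _ F (fun _ => rfl) x)

lemma A.of_ext (f : A U) : A.of U (SubmanifoldSchrodinger.ext U f) f.2 = f := A.ext fun x => ext_apply U f x

/-- The partial derivative as a derivation of the algebra of analytic functions. -/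
def pdDer (U : TopologicalSpace.Opens (ι → ℝ)) (i : ι) : Derivation ℂ (A U) (A U) :=
  Derivation.mk' (pd U i) fun f g => by
    ext x
    have h : ext U (f * g : A U) =ᶠ[nhds (x : ι → ℝ)] ext U f * ext U g :=
      ext_eventuallyEq U _ _ (fun y => by simp only [Pi.mul_apply, ext_apply]; rfl) x
    change fderiv ℝ (ext U (f * g : A U)) x _ = f x * fderiv ℝ (ext U g) x _ +
      g x * fderiv ℝ (ext U f) x _
    rw [h.fderiv_eq, fderiv_mul (f.2 x).differentiableAt (g.2 x).differentiableAt]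
    simp [ext_apply]

lemma pdDer_apply (i : ι) (f : A U) : pdDer U i f = pd U i f := rfl

lemma pd_mul (i : ι) (f g : A U) : pd U i (f * g) = f * pd U i g + g * pd U i f :=
  (pdDer U i).leibniz f g

lemma partialDeriv_comm {F : Type} [NormedAddCommGroup F] [NormedSpace ℝ F] [CompleteSpace F]
    (i j : ι) {f : (ι → ℝ) → F} {x : ι → ℝ} (h : AnalyticAt ℝ f x) :
    partialDeriv i (partialDeriv j f) x = partialDeriv j (partialDeriv i f) x := by
  have h1 : ∀ i j, partialDeriv i (partialDeriv j f) x =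
      fderiv ℝ (fderiv ℝ f) x (Pi.single i 1) (Pi.single j 1) := by
    intro i j
    change fderiv ℝ (fun y => fderiv ℝ f y (Pi.single j 1)) x (Pi.single i 1) = _
    rw [fderiv_clm_apply h.fderiv.differentiableAt (differentiableAt_const _)]
    simp
  rw [h1, h1]
  exact (h.contDiffAt (n := ⊤)).isSymmSndFDerivAt_of_omega _ _

lemma pd_comm (i j : ι) (f : A U) : pd U i (pd U j f) = pd U j (pd U i f) := by
  obtain ⟨F, hF, rfl⟩ : ∃ F hF, f = A.of U F hF := ⟨_, f.2, (A.of_ext f).symm⟩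
  simp only [pd_of]
  exact A.ext fun x => partialDeriv_comm i j (hF x)

lemma pdDer_comm (i j : ι) (f : A U) :
    pdDer U i (pdDer U j f) = pdDer U j (pdDer U i f) := by
  simp only [pdDer_apply]
  exact pd_comm i j f

/-- The components of an analytic map to Euclidean space, as elements of `A U`. -/
def A.component {n : ℕ} (U : TopologicalSpace.Opens (ι → ℝ))
    (X : (ι → ℝ) → EuclideanSpace ℝ (Fin n)) (hX : ∀ x : U, AnalyticAt ℝ X x) (m : Fin n) : A U :=
  A.of U (fun x => (X x m : ℂ)) fun x =>
    analyticAt_ofReal (analyticAt_apply (hX x) m)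

lemma pd_component {n : ℕ} (X : (ι → ℝ) → EuclideanSpace ℝ (Fin n))
    (hX : ∀ x : U, AnalyticAt ℝ X x) (m : Fin n) (i : ι) :
    pd U i (A.component U X hX m) =
      A.component U (partialDeriv i X) (fun x => analyticAt_partialDeriv i (hX x)) m := by
  rw [A.component, pd_of]
  refine A.ext fun x => ?_
  have h := (((Complex.ofRealCLM.comp (EuclideanSpace.proj m :
    EuclideanSpace ℝ (Fin n) →L[ℝ] ℝ)).hasFDerivAt).comp _ (hX x).differentiableAt.hasFDerivAt).fderiv
  change fderiv ℝ (fun y => ((X y m : ℝ) : ℂ)) _ _ = _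
  exact congrArg (fun L => L (Pi.single i 1)) h

/-- The `i`-th coordinate function. -/
def A.coord (U : TopologicalSpace.Opens (ι → ℝ)) (i : ι) : A U :=
  A.of U (fun x => (x i : ℂ)) fun _ => analyticAt_ofReal (analyticAt_coord i _)

lemma pd_coord (i j : ι) : pd U i (A.coord U j) = if i = j then 1 else 0 := by
  rw [A.coord, pd_of]
  refine A.ext fun x => ?_
  have h := (Complex.ofRealCLM.comp (ContinuousLinearMap.proj (R := ℝ) (φ := fun _ : ι => ℝ)
    j)).hasFDerivAt (x := (x : ι → ℝ)) |>.fderiv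
  refine (congrArg (fun L => L (Pi.single i 1)) h).trans ?_
  change ((Pi.single i (1 : ℝ) : ι → ℝ) j : ℂ) = _
  rw [Pi.single_apply]
  split_ifs with h1 h2 h2
  · rw [Complex.ofReal_one]; rfl
  · exact absurd h1.symm h2
  · exact absurd h2.symm h1
  · rw [Complex.ofReal_zero]; rfl

end Functions

/-! ### Differential operators -/

section Operators

variable {ι : Type} [Fintype ι] [DecidableEq ι] {U : TopologicalSpace.Opens (ι → ℝ)}

lemma D.ext {P Q : D U} (h : ∀ f x, P.app f x = Q.app f x) : P = Q :=
  Subtype.ext (LinearMap.ext fun f => A.ext (h f))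

lemma D.app_mul (P Q : D U) : (P * Q).app = P.app * Q.app := rfl

lemma D.app_add (P Q : D U) : (P + Q).app = P.app + Q.app := rfl

lemma D.app_sub (P Q : D U) : (P - Q).app = P.app - Q.app := rfl

lemma D.app_neg (P : D U) : (-P).app = -P.app := rfl

lemma D.app_one : (1 : D U).app = 1 := rfl

/-- The action of differential operators on analytic functions, as a ring homomorphism. -/
def D.appHom : D U →+* Module.End ℂ (A U) := (diffOps U).val.toRingHom

lemma D.app_sum {κ : Type*} (s : Finset κ) (P : κ → D U) : (∑ i ∈ s, P i).app = ∑ i ∈ s, (P i).app :=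
  map_sum D.appHom P s

/-- Multiplication by an analytic function, as a differential operator. -/
def D.mult (f : A U) : D U := ⟨_, Algebra.subset_adjoin (Or.inl ⟨f, rfl⟩)⟩

/-- A partial derivative, as a differential operator. -/
def D.pd (i : ι) : D U := ⟨_, Algebra.subset_adjoin (Or.inr ⟨i, rfl⟩)⟩

lemma ad_mult_mult (f g : A U) : ad (mult U f) (mult U g) = 0 := by
  refine LinearMap.ext fun h => ?_
  change g * (f * h) - f * (g * h) = 0
  ring

lemma ad_mult_pd (f : A U) (i : ι) : ad (mult U f) (pd U i) = mult U (pd U i f) := by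
  refine LinearMap.ext fun h => ?_
  change pd U i (f * h) - f * pd U i h = pd U i f * h
  rw [pd_mul]
  ring

/-- Differential operators have finite order. -/
lemma exists_iterate_ad_eq_zero (f : A U) (P : D U) :
    ∃ n, (ad (mult U f))^[n] P.app = 0 := by
  have h : ∀ Q ∈ diffOps U, ∃ n, (ad (mult U f))^[n] Q = 0 := by
    intro Q hQ
    induction hQ using Algebra.adjoin_induction with
    | mem Q hQ =>
      rcases hQ with ⟨g, rfl⟩ | ⟨i, rfl⟩
      · exact ⟨1, ad_mult_mult f g⟩
      · refine ⟨2, ?_⟩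
        rw [Function.iterate_succ_apply, ad_mult_pd]
        exact ad_mult_mult _ _
    | algebraMap c =>
      refine ⟨1, ?_⟩
      refine LinearMap.ext fun g => ?_
      change c • (f * g) - f * c • g = 0
      rw [mul_smul_comm, sub_self]
    | add P Q _ _ hP hQ =>
      obtain ⟨m, hm⟩ := hP
      obtain ⟨n, hn⟩ := hQ
      refine ⟨m + n, ?_⟩
      rw [iterate_map_add, add_comm m n, Function.iterate_add_apply, hm, iterate_map_zero,
        add_comm n m, Function.iterate_add_apply, hn, iterate_map_zero, add_zero]
    | mul P Q _ _ hP hQ =>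
      obtain ⟨m, hm⟩ := hP
      obtain ⟨n, hn⟩ := hQ
      exact exists_iterate_ad_mul_eq_zero m n hm hn
  exact h _ P.2

instance : IsAddTorsionFree (Module.End ℂ (A U)) := by
  have : Module ℚ (Module.End ℂ (A U)) := Module.compHom _ (algebraMap ℚ ℂ)
  exact IsAddTorsionFree.of_module_rat _

/-- The operator `∑ h α β ∂_α ∂_β + ∑ b α ∂_α + v`. -/
def secondOrder (h : Matrix ι ι (A U)) (b : ι → A U) (v : A U) : D U :=
  ∑ α, ∑ β, D.mult (h α β) * D.pd α * D.pd β + ∑ α, D.mult (b α) * D.pd α + D.mult v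

lemma secondOrder_app (h : Matrix ι ι (A U)) (b : ι → A U) (v ψ : A U) :
    (secondOrder h b v).app ψ = ∑ α, ∑ β, h α β * pd U α (pd U β ψ) + ∑ α, b α * pd U α ψ + v * ψ := by
  simp only [secondOrder, D.app_add, D.app_sum, LinearMap.add_apply, LinearMap.sum_apply]
  rfl

lemma secondOrder_app_eq (h : Matrix ι ι (A U)) (b : ι → A U) (v : A U) :
    (secondOrder h b v).app = ∑ α, ∑ β, mult U (h α β) * pd U α * pd U β +
      ∑ α, mult U (b α) * pd U α + mult U v := by
  simp only [secondOrder, D.app_add, D.app_sum]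
  rfl

/-- An elliptic operator of order two has no right multiple, other than zero, that commutes with a
coordinate. -/
lemma eq_zero_of_commute_mul_secondOrder (i : ι) {h : Matrix ι ι (A U)} (hi : IsUnit (h i i))
    (b : ι → A U) (v : A U) (P : D U)
    (hP : ad (mult U (A.coord U i)) (P * secondOrder h b v).app = 0) : P = 0 := by
  have hm1 : ∀ (p : Prop) [Decidable p],
      mult U (if p then (1 : A U) else 0) = if p then 1 else 0 := by
    intro p _
    refine LinearMap.ext fun g => ?_
    change (if p then (1 : A U) else 0) * g = _
    split_ifs <;> simp
  have h1 : ad (mult U (A.coord U i)) (secondOrder h b v).app =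
      ∑ α, mult U (h i α) * pd U α + ∑ α, mult U (h α i) * pd U α + mult U (b i) := by
    rw [secondOrder_app_eq]
    simp only [map_add, map_sum, ad_mul, ad_mult_mult, ad_mult_pd, pd_coord, hm1, zero_mul, zero_add,
      mul_ite, ite_mul, mul_one, mul_zero, Finset.sum_add_distrib, Finset.sum_ite_eq',
      Finset.mem_univ, if_true, add_zero]
    congr 2
    rw [Finset.sum_comm]
    simp
  have h2 : ad (mult U (A.coord U i)) (ad (mult U (A.coord U i)) (secondOrder h b v).app) =
      mult U (h i i + h i i) := by
    rw [h1]
    simp only [map_add, map_sum, ad_mul, ad_mult_mult, ad_mult_pd, pd_coord, hm1, zero_mul, zero_add,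
      mul_ite, mul_one, mul_zero, Finset.sum_ite_eq', Finset.mem_univ, if_true, add_zero]
    refine LinearMap.ext fun g => ?_
    change h i i * g + h i i * g = (h i i + h i i) * g
    ring
  obtain ⟨u, hu⟩ := hi
  have hcancel : ∀ Q : Module.End ℂ (A U), Q * mult U (h i i + h i i) = 0 → Q = 0 := by
    intro Q hQ
    refine LinearMap.ext fun g => ?_
    have h3 := LinearMap.congr_fun hQ ((2 : ℂ)⁻¹ • (↑u⁻¹ * g))
    change Q ((h i i + h i i) * ((2 : ℂ)⁻¹ • (↑u⁻¹ * g))) = 0 at h3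
    rw [← hu, mul_smul_comm, ← mul_assoc, add_mul, Units.mul_inv, ← two_smul ℂ (1 : A U), smul_mul_assoc,
      one_mul, smul_smul, inv_mul_cancel₀ two_ne_zero, one_smul] at h3
    exact h3
  obtain ⟨n, hn⟩ := exists_iterate_ad_eq_zero (A.coord U i) P
  rw [D.app_mul] at hP
  have := eq_zero_of_ad_mul_eq_zero h2 (ad_mult_mult _ _) hcancel hn hP
  exact Subtype.ext this

end Operators

namespace Tube

variable {k n d : ℕ} {S : Patch k n} (t : Tube S d)

/-! ### The Euclidean frame on a tube -/

/-- The Cartesian coordinate functions of `𝔼ⁿ` on the tube. -/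
def cartesian (m : Fin n) : A t.T := A.component t.T t.Φ t.analyticAt_Φ m

/-- The Jacobian matrix of `Φ`. -/
def jacobian : Matrix (Fin k ⊕ Fin d) (Fin n) (A t.T) := .of fun i m => pd t.T i (t.cartesian m)

/-- The Gram matrix of the metric on the tube. -/
def gramT : Matrix (Fin k ⊕ Fin d) (Fin k ⊕ Fin d) (A t.T) := t.jacobian * t.jacobianᵀ

lemma eval_jacobian (u : t.T) (i : Fin k ⊕ Fin d) (m : Fin n) :
    A.eval u (t.jacobian i m) = (partialDeriv i t.Φ u m : ℂ) := by
  rw [jacobian, Matrix.of_apply, cartesian, pd_component]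
  rfl

lemma ofReal_inner {n : ℕ} (v w : EuclideanSpace ℝ (Fin n)) :
    ((⟪v, w⟫_ℝ : ℝ) : ℂ) = ∑ m, (v m : ℂ) * (w m : ℂ) := by
  rw [PiLp.inner_apply, Complex.ofReal_sum]
  refine Finset.sum_congr rfl fun m _ => ?_
  rw [← Complex.ofReal_mul]
  congr 1
  simp [mul_comm]

lemma eval_gramT (u : t.T) (i j : Fin k ⊕ Fin d) :
    A.eval u (t.gramT i j) = (Matrix.gram ℝ (fun μ => partialDeriv μ t.Φ u) i j : ℂ) := by
  rw [Matrix.gram_apply, ofReal_inner, gramT, Matrix.mul_apply, map_sum]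
  simp only [map_mul, Matrix.transpose_apply, eval_jacobian]

lemma det_gramT : t.gramT.det = (t.halfForm : A t.T) ^ 4 := by
  refine A.ext_eval fun u => ?_
  have h1 : A.eval u t.gramT.det = (t.detMetric u : ℂ) := by
    rw [detMetric, AlgHom.map_det]
    change _ = Complex.ofRealHom _
    rw [RingHom.map_det]
    congr 1
    ext i j
    exact t.eval_gramT u i j
  have h2 : A.eval u (t.halfForm : A t.T) = ((t.detMetric u ^ (1 / 4 : ℝ) : ℝ) : ℂ) := rfl
  rw [h1, map_pow, h2, ← Complex.ofReal_pow, ← Real.rpow_natCast, ← Real.rpow_mul (t.detMetric_pos u).le]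
  norm_num

lemma isUnit_det_gramT : IsUnit t.gramT.det := by
  rw [det_gramT]
  exact t.halfForm.isUnit.pow 4

/-- The inverse of the Jacobian matrix. -/
def invJacobian : Matrix (Fin n) (Fin k ⊕ Fin d) (A t.T) := t.jacobianᵀ * t.gramT⁻¹

lemma jacobian_mul_inv : t.jacobian * t.invJacobian = 1 := by
  rw [invJacobian, ← Matrix.mul_assoc]
  exact Matrix.mul_nonsing_inv _ t.isUnit_det_gramT

lemma inv_mul_jacobian (hn : k + d = n) : t.invJacobian * t.jacobian = 1 :=
  (Matrix.mul_eq_one_comm_of_card_eq _ _ _ (by simp [hn])).1 t.jacobian_mul_inv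

/-- The vector fields on the tube that correspond to the partial derivatives of `𝔼ⁿ`. -/
def euclid (m : Fin n) : Derivation ℂ (A t.T) (A t.T) := frame t.invJacobian (pdDer t.T) m

lemma euclid_apply (m : Fin n) (f : A t.T) :
    t.euclid m f = ∑ i, t.invJacobian m i * pd t.T i f := frame_apply m f

lemma sum_jacobian_mul_euclid (i : Fin k ⊕ Fin d) (f : A t.T) :
    ∑ m, t.jacobian i m * t.euclid m f = pd t.T i f := sum_mul_frame t.jacobian_mul_inv i f

lemma euclid_cartesian (hn : k + d = n) (l m : Fin n) :
    t.euclid l (t.cartesian m) = if l = m then 1 else 0 :=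
  frame_coordinate (fun _ _ => rfl) (t.inv_mul_jacobian hn) l m

lemma euclid_comm (hn : k + d = n) (l m : Fin n) (f : A t.T) :
    t.euclid l (t.euclid m f) = t.euclid m (t.euclid l f) :=
  frame_comm (δ := pdDer t.T) (y := t.cartesian) pdDer_comm (fun _ _ => rfl)
    (t.inv_mul_jacobian hn) t.jacobian_mul_inv l m f

lemma analyticAt_directional {F : EuclideanSpace ℝ (Fin n) → ℂ} {y : EuclideanSpace ℝ (Fin n)}
    (hF : AnalyticAt ℝ F y) (v : EuclideanSpace ℝ (Fin n)) :
    AnalyticAt ℝ (fun z => fderiv ℝ F z v) y :=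
  ((ContinuousLinearMap.apply ℝ ℂ v).analyticAt _).comp hF.fderiv

lemma euclid_pullback (hn : k + d = n) (F : EuclideanSpace ℝ (Fin n) → ℂ)
    (hF : ∀ y, AnalyticAt ℝ F y) (m : Fin n) :
    t.euclid m (t.pullback F hF) =
      t.pullback (fun y => fderiv ℝ F y (EuclideanSpace.basisFun (Fin n) ℝ m))
        fun y => analyticAt_directional (hF y) _ := by
  have h : ∀ i, pd t.T i (t.pullback F hF) = ∑ l, t.jacobian i l *
      t.pullback (fun y => fderiv ℝ F y (EuclideanSpace.basisFun (Fin n) ℝ l))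
        fun y => analyticAt_directional (hF y) _ := by
    intro i
    rw [pullback, pd_of]
    refine A.ext_eval fun u => ?_
    rw [A.eval_of, map_sum]
    simp only [map_mul, eval_jacobian]
    change fderiv ℝ (F ∘ t.Φ) u (Pi.single i 1) = ∑ l, _ *
      fderiv ℝ F (t.Φ u) (EuclideanSpace.basisFun (Fin n) ℝ l)
    rw [fderiv_comp _ (hF _).differentiableAt (t.analyticAt_Φ u).differentiableAt,
      ContinuousLinearMap.comp_apply]
    change fderiv ℝ F (t.Φ u) (partialDeriv i t.Φ u) = _
    conv_lhs => rw [← (EuclideanSpace.basisFun (Fin n) ℝ).sum_repr (partialDeriv i t.Φ u), map_sum]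
    refine Finset.sum_congr rfl fun l _ => ?_
    rw [map_smul, EuclideanSpace.basisFun_repr, Complex.real_smul]
  rw [euclid_apply]
  simp only [h, Finset.mul_sum]
  rw [Finset.sum_comm]
  simp only [← mul_assoc, ← Finset.sum_mul]
  simp only [← Matrix.mul_apply, t.inv_mul_jacobian hn, Matrix.one_apply, ite_mul, one_mul, zero_mul,
    Finset.sum_ite_eq, Finset.mem_univ, if_true]

/-- The operator on the tube that corresponds to the Euclidean `-Δ`. -/
def schrodinger : D t.T :=
  -∑ m, (∑ i, D.mult (t.invJacobian m i) * D.pd i) * ∑ i, D.mult (t.invJacobian m i) * D.pd i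

lemma schrodinger_app (f : A t.T) : t.schrodinger.app f = -∑ m, t.euclid m (t.euclid m f) := by
  have h : ∀ (m : Fin n) (f : A t.T),
      (∑ i, D.mult (t.invJacobian m i) * D.pd i : D t.T).app f = t.euclid m f := by
    intro m f
    rw [euclid_apply, D.app_sum, LinearMap.sum_apply]
    rfl
  rw [schrodinger, D.app_neg, D.app_sum, LinearMap.neg_apply, LinearMap.sum_apply]
  congr 1
  refine Finset.sum_congr rfl fun m _ => ?_
  rw [D.app_mul, Module.End.mul_apply, h, h]

lemma isSchrodinger_schrodinger (hn : k + d = n) : t.IsSchrodinger t.schrodinger := by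
  intro F hF u
  rw [schrodinger_app]
  simp only [t.euclid_pullback hn]
  rw [InnerProductSpace.laplacian_eq_iteratedFDeriv_orthonormalBasis F
    (EuclideanSpace.basisFun (Fin n) ℝ), ← A.eval_apply, map_neg, map_sum]
  congr 1
  refine Finset.sum_congr rfl fun m _ => ?_
  change fderiv ℝ (fun y => fderiv ℝ F y _) (t.Φ u) _ = _
  rw [fderiv_clm_apply (hF _).fderiv.differentiableAt (differentiableAt_const _),
    iteratedFDeriv_two_apply]
  simp

/-! ### Uniqueness of the Schrödinger operator of a tube -/

lemma exists_app_mem_vanishing (u : t.T) (P : D t.T) :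
    ∃ N, ∀ M, ∀ f ∈ vanishing (A.eval u) t.euclid (M + N),
      P.app f ∈ vanishing (A.eval u) t.euclid M := by
  have hanti : ∀ {M N : ℕ}, M ≤ N → vanishing (A.eval u) t.euclid N ≤
      vanishing (A.eval u) t.euclid M := fun h =>
    antitone_nat_of_succ_le (fun M => vanishing_succ_le M) h
  have h : ∀ Q ∈ diffOps t.T, ∃ N, ∀ M, ∀ f ∈ vanishing (A.eval u) t.euclid (M + N),
      Q f ∈ vanishing (A.eval u) t.euclid M := by
    intro Q hQ
    induction hQ using Algebra.adjoin_induction with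
    | mem Q hQ =>
      rcases hQ with ⟨g, rfl⟩ | ⟨i, rfl⟩
      · exact ⟨0, fun M f hf => mul_mem_vanishing g hf⟩
      · refine ⟨1, fun M f hf => ?_⟩
        rw [← sum_jacobian_mul_euclid]
        exact sum_mem fun m _ => mul_mem_vanishing _ ((mem_vanishing_succ.1 hf).2 m)
    | algebraMap c => exact ⟨0, fun M f hf => Submodule.smul_mem _ c hf⟩
    | add P Q _ _ hP hQ =>
      obtain ⟨a, ha⟩ := hP
      obtain ⟨b, hb⟩ := hQ
      exact ⟨a + b, fun M f hf => add_mem (ha M f (hanti (by omega) hf))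
        (hb M f (hanti (by omega) hf))⟩
    | mul P Q _ _ hP hQ =>
      obtain ⟨a, ha⟩ := hP
      obtain ⟨b, hb⟩ := hQ
      exact ⟨a + b, fun M f hf => ha M _ (hb _ f (hanti (by omega) hf))⟩
  exact h _ P.2

lemma exists_eq_pullback {p : A t.T} (hp : p ∈ Algebra.adjoin ℂ (Set.range t.cartesian)) :
    ∃ F hF, p = t.pullback F hF := by
  induction hp using Algebra.adjoin_induction with
  | mem p hp =>
    obtain ⟨m, rfl⟩ := hp
    exact ⟨fun y => (y m : ℂ), fun y => (Complex.ofRealCLM.analyticAt _).comp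
      ((EuclideanSpace.proj m : EuclideanSpace ℝ (Fin n) →L[ℝ] ℝ).analyticAt _), rfl⟩
  | algebraMap c => exact ⟨fun _ => c, fun _ => analyticAt_const, rfl⟩
  | add p q _ _ hp hq =>
    obtain ⟨F, hF, rfl⟩ := hp
    obtain ⟨F', hF', rfl⟩ := hq
    exact ⟨F + F', fun y => (hF y).add (hF' y), rfl⟩
  | mul p q _ _ hp hq =>
    obtain ⟨F, hF, rfl⟩ := hp
    obtain ⟨F', hF', rfl⟩ := hq
    exact ⟨F * F', fun y => (hF y).mul (hF' y), rfl⟩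

/-- The values of a differential operator are determined by its action on the polynomials in the
Cartesian coordinates, since it depends on finite jets only and every jet is that of
a polynomial. -/
lemma IsSchrodinger.eq (hn : k + d = n) {P Q : D t.T} (hP : t.IsSchrodinger P)
    (hQ : t.IsSchrodinger Q) : P = Q := by
  refine D.ext fun f u => ?_
  obtain ⟨N, hN⟩ := t.exists_app_mem_vanishing u (P - Q)
  obtain ⟨p, hp, hfp⟩ := exists_sub_mem_vanishing (φ := A.eval u) (t.euclid_comm hn)
    (t.euclid_cartesian hn) (1 + N) f
  obtain ⟨F, hF, rfl⟩ := t.exists_eq_pullback hp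
  have h1 := (mem_vanishing_succ.1 (hN 1 _ hfp)).1
  have h2 : A.eval u ((P - Q).app (t.pullback F hF)) = 0 := by
    rw [D.app_sub, LinearMap.sub_apply, map_sub, A.eval_apply, A.eval_apply, hP, hQ, sub_self]
  rw [map_sub, map_sub, h2, sub_zero, D.app_sub, LinearMap.sub_apply, map_sub] at h1
  exact sub_eq_zero.1 h1

/-! ### Restriction to the zero section and extension from it -/

/-- The linear map `s ↦ (s, 0)`. -/
def zeroSection (k d : ℕ) : (Fin k → ℝ) →L[ℝ] (Fin k ⊕ Fin d → ℝ) :=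
  ContinuousLinearMap.pi (Sum.elim (fun i => ContinuousLinearMap.proj i) 0)

lemma zeroSection_apply (x : Fin k → ℝ) : zeroSection k d x = Sum.elim x 0 := by
  ext i
  rcases i with i | i <;> rfl

/-- The linear map `(s, q) ↦ s`. -/
def projection (k d : ℕ) : (Fin k ⊕ Fin d → ℝ) →L[ℝ] (Fin k → ℝ) :=
  ContinuousLinearMap.pi fun i => ContinuousLinearMap.proj (Sum.inl i)

/-- The point of the zero section over `x`. -/
def zeroPoint (x : S.U) : t.T := ⟨Sum.elim x 0, t.zero_mem x x.2⟩

lemma toS_apply (f : A t.T) (x : S.U) : t.toS f x = f (t.zeroPoint x) :=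
  ext_apply t.T f (t.zeroPoint x)

/-- Restriction to the zero section, as a homomorphism of algebras. -/
def toSHom : A t.T →ₐ[ℂ] A S.U :=
  AlgHom.ofLinearMap t.toS (A.ext fun x => by rw [toS_apply]; rfl) fun f g => A.ext fun x => by
    change _ = t.toS f x * t.toS g x
    simp only [toS_apply]
    rfl

lemma toSHom_apply (f : A t.T) : t.toSHom f = t.toS f := rfl

lemma eval_toSHom (f : A t.T) (x : S.U) : A.eval x (t.toSHom f) = A.eval (t.zeroPoint x) f :=
  t.toS_apply f x

lemma pd_toSHom (α : Fin k) (f : A t.T) :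
    pd S.U α (t.toSHom f) = t.toSHom (pd t.T (Sum.inl α) f) := by
  refine A.ext_eval fun x => ?_
  rw [eval_toSHom]
  have h1 : SubmanifoldSchrodinger.ext S.U (t.toSHom f) =ᶠ[nhds (x : Fin k → ℝ)]
      SubmanifoldSchrodinger.ext t.T f ∘ zeroSection k d :=
    ext_eventuallyEq S.U _ _ (fun y => by rw [Function.comp_apply, zeroSection_apply]; rfl) x
  change fderiv ℝ _ _ _ = fderiv ℝ _ _ _
  have h2 : DifferentiableAt ℝ (SubmanifoldSchrodinger.ext t.T f) (zeroSection k d x) := by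
    rw [zeroSection_apply]
    exact (f.2 (t.zeroPoint x)).differentiableAt
  rw [h1.fderiv_eq, fderiv_comp _ h2 (zeroSection k d).differentiableAt,
    ContinuousLinearMap.fderiv, ContinuousLinearMap.comp_apply, zeroSection_apply, zeroSection_apply]
  congr 1
  ext i
  rcases i with i | i <;> simp [Pi.single_apply]

/-- Extension of functions on `S` to the tube, independently of `q`. -/
def extend : A S.U →ₐ[ℂ] A t.T where
  toFun f := A.of t.T (SubmanifoldSchrodinger.ext S.U f ∘ projection k d) fun u =>
    (f.2 ⟨_, t.proj_mem u u.2⟩).comp_of_eq ((projection k d).analyticAt _) rfl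
  map_one' := A.ext fun u => ext_apply S.U _ ⟨_, t.proj_mem u u.2⟩
  map_mul' f g := A.ext fun u => by
    refine (ext_apply S.U _ ⟨_, t.proj_mem u u.2⟩).trans ?_
    exact (congrArg₂ (· * ·) (ext_apply S.U f ⟨_, t.proj_mem u u.2⟩)
      (ext_apply S.U g ⟨_, t.proj_mem u u.2⟩)).symm
  map_zero' := A.ext fun u => ext_apply S.U _ ⟨_, t.proj_mem u u.2⟩
  map_add' f g := A.ext fun u => by
    refine (ext_apply S.U _ ⟨_, t.proj_mem u u.2⟩).trans ?_
    exact (congrArg₂ (· + ·) (ext_apply S.U f ⟨_, t.proj_mem u u.2⟩)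
      (ext_apply S.U g ⟨_, t.proj_mem u u.2⟩)).symm
  commutes' c := A.ext fun u => ext_apply S.U _ ⟨_, t.proj_mem u u.2⟩

lemma extend_apply (f : A S.U) :
    t.extend f = A.of t.T (SubmanifoldSchrodinger.ext S.U f ∘ projection k d) fun u =>
      (f.2 ⟨_, t.proj_mem u u.2⟩).comp_of_eq ((projection k d).analyticAt _) rfl := rfl

lemma eval_extend (f : A S.U) (u : t.T) :
    A.eval u (t.extend f) = f ⟨(u : Fin k ⊕ Fin d → ℝ) ∘ Sum.inl, t.proj_mem u u.2⟩ :=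
  ext_apply S.U f ⟨_, t.proj_mem u u.2⟩

lemma toSHom_extend (f : A S.U) : t.toSHom (t.extend f) = f := by
  refine A.ext_eval fun x => ?_
  rw [eval_toSHom, eval_extend]
  rfl

lemma eval_pd_extend (i : Fin k ⊕ Fin d) (f : A S.U) (u : t.T) :
    A.eval u (pd t.T i (t.extend f)) = fderiv ℝ (SubmanifoldSchrodinger.ext S.U f)
      (projection k d u) (projection k d (Pi.single i 1)) := by
  rw [extend_apply, pd_of, A.eval_of]
  have h2 : DifferentiableAt ℝ (SubmanifoldSchrodinger.ext S.U f) (projection k d u) :=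
    (f.2 ⟨_, t.proj_mem u u.2⟩).differentiableAt
  rw [partialDeriv, fderiv_comp _ h2 (projection k d).differentiableAt,
    ContinuousLinearMap.fderiv, ContinuousLinearMap.comp_apply]

lemma pd_inl_extend (α : Fin k) (f : A S.U) :
    pd t.T (Sum.inl α) (t.extend f) = t.extend (pd S.U α f) := by
  refine A.ext_eval fun u => ?_
  rw [eval_pd_extend, eval_extend]
  change _ = fderiv ℝ _ _ _
  congr 1
  ext i
  simp [projection, Pi.single_apply]

lemma pd_inr_extend (a : Fin d) (f : A S.U) : pd t.T (Sum.inr a) (t.extend f) = 0 := by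
  refine A.ext_eval fun u => ?_
  rw [eval_pd_extend]
  have h : projection k d (Pi.single (Sum.inr a) 1) = 0 := by
    ext i
    simp [projection]
  rw [h, map_zero, map_zero]

end Tube

/-! ### First fundamental form -/

namespace Patch

variable {k n : ℕ} (S : Patch k n)

/-- The Cartesian coordinates of the patch, as analytic functions of its parameters. -/
def cartesian (m : Fin n) : A S.U := A.component S.U S.X (fun x => S.analytic x x.2) m

/-- The Jacobian matrix of the parametrisation. -/
def jacobian : Matrix (Fin k) (Fin n) (A S.U) := .of fun α m => pd S.U α (S.cartesian m)

/-- The first fundamental form, as a matrix of analytic functions. -/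
def gram : Matrix (Fin k) (Fin k) (A S.U) := S.jacobian * S.jacobianᵀ

lemma eval_jacobian (x : S.U) (α : Fin k) (m : Fin n) :
    A.eval x (S.jacobian α m) = (partialDeriv α S.X x m : ℂ) := by
  rw [jacobian, Matrix.of_apply, cartesian, pd_component]
  rfl

lemma eval_gram (x : S.U) (α β : Fin k) : A.eval x (S.gram α β) = (S.metric x α β : ℂ) := by
  rw [metric, Matrix.gram_apply, Tube.ofReal_inner, gram, Matrix.mul_apply, map_sum]
  simp only [map_mul, Matrix.transpose_apply, eval_jacobian]

lemma gram_symm (α β : Fin k) : S.gram α β = S.gram β α := by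
  rw [gram, Matrix.mul_apply, Matrix.mul_apply]
  exact Finset.sum_congr rfl fun m _ => mul_comm _ _

lemma transpose_gram : S.gramᵀ = S.gram := by
  exact Matrix.ext fun α β => S.gram_symm β α

lemma posDef_metric (x : S.U) : (S.metric x).PosDef := by
  refine Matrix.posDef_gram_of_linearIndependent (𝕜 := ℝ) ?_
  exact (Pi.linearIndependent_single_one (Fin k) ℝ).map' _
    (LinearMap.ker_eq_bot.2 (S.immersion x x.2))

lemma eval_det_gram (x : S.U) : A.eval x S.gram.det = ((S.metric x).det : ℂ) := by
  rw [AlgHom.map_det]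
  change _ = Complex.ofRealHom _
  rw [RingHom.map_det]
  congr 1
  ext i j
  exact S.eval_gram x i j

lemma isUnit_det_gram : IsUnit S.gram.det := by
  refine A.isUnit fun x => ?_
  rw [← A.eval_apply, eval_det_gram]
  exact_mod_cast (S.posDef_metric x).det_pos.ne'

lemma eval_inv_gram (x : S.U) (α β : Fin k) :
    A.eval x (S.gram⁻¹ α β) = ((S.metric x)⁻¹ α β : ℂ) := by
  have h1 : (A.eval x).mapMatrix S.gram * (A.eval x).mapMatrix S.gram⁻¹ = 1 := by
    rw [← map_mul, Matrix.mul_nonsing_inv _ S.isUnit_det_gram, map_one]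
  have h2 : Complex.ofRealHom.mapMatrix (S.metric x) *
      Complex.ofRealHom.mapMatrix (S.metric x)⁻¹ = 1 := by
    rw [← map_mul, Matrix.mul_nonsing_inv _ (S.posDef_metric x).det_pos.ne'.isUnit, map_one]
  have h3 : (A.eval x).mapMatrix S.gram = Complex.ofRealHom.mapMatrix (S.metric x) := by
    ext i j
    exact S.eval_gram x i j
  rw [h3] at h1
  have h4 := (Matrix.inv_eq_right_inv h1).symm.trans (Matrix.inv_eq_right_inv h2)
  exact congrFun (congrFun h4 α) β

lemma isUnit_inv_gram_diag (α : Fin k) : IsUnit (S.gram⁻¹ α α) := by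
  refine A.isUnit fun x => ?_
  rw [← A.eval_apply, eval_inv_gram]
  exact_mod_cast ((S.posDef_metric x).inv.diag_pos (i := α)).ne'

/-- The lowered Christoffel symbols `⟪∂_α ∂_β X, ∂_γ X⟫`. -/
def christoffel (α β γ : Fin k) : A S.U :=
  ∑ m, pd S.U α (pd S.U β (S.cartesian m)) * S.jacobian γ m

lemma pd_gram (α β γ : Fin k) :
    pd S.U α (S.gram β γ) = S.christoffel α β γ + S.christoffel α γ β := by
  rw [gram, Matrix.mul_apply, map_sum, christoffel, christoffel, ← Finset.sum_add_distrib]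
  refine Finset.sum_congr rfl fun m _ => ?_
  rw [Matrix.transpose_apply, pd_mul, add_comm, jacobian, Matrix.of_apply, Matrix.of_apply]
  ring

lemma christoffel_comm (α β γ : Fin k) : S.christoffel α β γ = S.christoffel β α γ := by
  simp only [christoffel, pd_comm α β]

/-- The coefficients `-g^{αβ} Γ^γ_{αβ}` of the first order part of the Beltrami-Laplace operator. -/
def drift (γ : Fin k) : A S.U :=
  -∑ δ, (∑ α, ∑ β, S.gram⁻¹ α β * S.christoffel α β δ) * S.gram⁻¹ δ γ

lemma eq_drift {b : Fin k → A S.U} (hb : ∀ γ, ∑ α, b α * S.gram α γ =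
    -∑ α, ∑ β, S.gram⁻¹ α β * S.christoffel α β γ) : b = S.drift := by
  have h1 : b ᵥ* S.gram = fun γ => -∑ α, ∑ β, S.gram⁻¹ α β * S.christoffel α β γ := funext hb
  have h2 := congrArg (· ᵥ* S.gram⁻¹) h1
  simp only [Matrix.vecMul_vecMul, Matrix.mul_nonsing_inv _ S.isUnit_det_gram,
    Matrix.vecMul_one] at h2
  rw [h2]
  ext1 γ
  simp only [Matrix.vecMul, dotProduct, drift, neg_mul, Finset.sum_neg_distrib]

end Patch

/-! ### The Euclidean Laplacian along the zero section -/

namespace Tube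

variable {k n d : ℕ} {S : Patch k n} (t : Tube S d)

/-- The components of the normal frame. -/
def normalFrame : Matrix (Fin d) (Fin n) (A S.U) :=
  .of fun a m => A.component S.U (t.N a) (fun x => t.analytic a x x.2) m

lemma eval_normalFrame (x : S.U) (a : Fin d) (m : Fin n) :
    A.eval x (t.normalFrame a m) = (t.N a x m : ℂ) := rfl

lemma normalFrame_mul_transpose : t.normalFrame * t.normalFrameᵀ = 1 := by
  refine Matrix.ext fun a b => ?_
  refine A.ext_eval fun x => ?_
  rw [Matrix.mul_apply, map_sum]
  simp only [map_mul, Matrix.transpose_apply, eval_normalFrame]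
  rw [← ofReal_inner, orthonormal_iff_ite.1 (t.orthonormal x x.2) a b, Matrix.one_apply]
  split_ifs <;> simp

lemma jacobian_mul_normalFrame : S.jacobian * t.normalFrameᵀ = 0 := by
  refine Matrix.ext fun α a => ?_
  refine A.ext_eval fun x => ?_
  rw [Matrix.mul_apply, map_sum]
  simp only [map_mul, Matrix.transpose_apply, eval_normalFrame, S.eval_jacobian]
  rw [← ofReal_inner, t.normal x x.2]
  simp

/-- The second fundamental forms `⟪∂_α ∂_β X, N_a⟫`. -/
def secondForm (a : Fin d) : Matrix (Fin k) (Fin k) (A S.U) :=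
  .of fun α β => ∑ m, pd S.U α (pd S.U β (S.cartesian m)) * t.normalFrame a m

lemma sum_jacobian_mul_pd_normalFrame (a : Fin d) (α β : Fin k) :
    ∑ m, S.jacobian α m * pd S.U β (t.normalFrame a m) = -t.secondForm a α β := by
  have h := congrArg (pd S.U β) (congrFun (congrFun t.jacobian_mul_normalFrame α) a)
  rw [Matrix.mul_apply, map_sum, Matrix.zero_apply, map_zero] at h
  simp only [Matrix.transpose_apply, pd_mul, Finset.sum_add_distrib] at h
  rw [eq_neg_of_add_eq_zero_left h, secondForm, Matrix.of_apply]
  congr 1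
  refine Finset.sum_congr rfl fun m _ => ?_
  rw [pd_comm, mul_comm]
  rfl

/-- The components of the mean curvature vector, without the factor `1 / k`. -/
def meanTrace (a : Fin d) : A S.U := ∑ α, ∑ β, S.gram⁻¹ α β * t.secondForm a α β

lemma cartesian_eq (m : Fin n) : t.cartesian m = t.extend (S.cartesian m) +
    ∑ a, A.coord t.T (Sum.inr a) * t.extend (t.normalFrame a m) := by
  refine A.ext_eval fun u => ?_
  rw [map_add, map_sum]
  simp only [map_mul, eval_extend]
  change ((normalMap S.X t.N u m : ℝ) : ℂ) = ((S.X _ m : ℝ) : ℂ) + ∑ a, (((u : Fin k ⊕ Fin d → ℝ) (Sum.inr a) : ℝ) : ℂ) *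
    ((t.N a _ m : ℝ) : ℂ)
  rw [normalMap]
  simp only [PiLp.add_apply, PiLp.smul_apply, WithLp.ofLp_sum, Finset.sum_apply, smul_eq_mul]
  push_cast
  rfl

lemma jacobian_inl (α : Fin k) (m : Fin n) : t.jacobian (Sum.inl α) m =
    t.extend (S.jacobian α m) +
      ∑ a, A.coord t.T (Sum.inr a) * t.extend (pd S.U α (t.normalFrame a m)) := by
  rw [jacobian, Matrix.of_apply, cartesian_eq, map_add, map_sum, pd_inl_extend]
  simp only [pd_mul, pd_inl_extend, pd_coord, reduceCtorEq, if_false, mul_zero, add_zero]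
  rfl

lemma jacobian_inr (a : Fin d) (m : Fin n) :
    t.jacobian (Sum.inr a) m = t.extend (t.normalFrame a m) := by
  rw [jacobian, Matrix.of_apply, cartesian_eq, map_add, map_sum, pd_inr_extend]
  simp only [pd_mul, pd_inr_extend, pd_coord, Sum.inr.injEq, mul_zero, zero_add, mul_ite, mul_one,
    Finset.sum_ite_eq, Finset.mem_univ, if_true]

lemma toSHom_coord (a : Fin d) : t.toSHom (A.coord t.T (Sum.inr a)) = 0 := by
  refine A.ext_eval fun x => ?_
  rw [eval_toSHom]
  change ((0 : ℝ) : ℂ) = 0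
  simp

lemma toSHom_jacobian_inl (α : Fin k) (m : Fin n) :
    t.toSHom (t.jacobian (Sum.inl α) m) = S.jacobian α m := by
  rw [jacobian_inl, map_add, map_sum, toSHom_extend]
  simp [toSHom_coord]

lemma toSHom_jacobian_inr (a : Fin d) (m : Fin n) :
    t.toSHom (t.jacobian (Sum.inr a) m) = t.normalFrame a m := by
  rw [jacobian_inr, toSHom_extend]

lemma toSHom_gramT : t.toSHom.mapMatrix t.gramT = Matrix.fromBlocks S.gram 0 0 1 := by
  have h0 : ∀ i j, t.toSHom (t.gramT i j) =
      ∑ m, t.toSHom (t.jacobian i m) * t.toSHom (t.jacobian j m) := fun i j => by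
    simp only [gramT, Matrix.mul_apply, Matrix.transpose_apply, map_sum, map_mul]
  refine Matrix.ext fun i j => ?_
  change t.toSHom (t.gramT i j) = _
  rw [h0]
  rcases i with α | a <;> rcases j with β | b <;>
    simp only [toSHom_jacobian_inl, toSHom_jacobian_inr, Matrix.fromBlocks_apply₁₁,
      Matrix.fromBlocks_apply₁₂, Matrix.fromBlocks_apply₂₁, Matrix.fromBlocks_apply₂₂]
  · rfl
  · exact congrFun (congrFun t.jacobian_mul_normalFrame α) b
  · simp only [mul_comm (t.normalFrame _ _)]
    exact congrFun (congrFun t.jacobian_mul_normalFrame β) a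
  · exact congrFun (congrFun t.normalFrame_mul_transpose a) b

lemma toSHom_inv_gramT :
    t.toSHom.mapMatrix t.gramT⁻¹ = Matrix.fromBlocks S.gram⁻¹ 0 0 1 := by
  have h1 : t.toSHom.mapMatrix t.gramT * t.toSHom.mapMatrix t.gramT⁻¹ = 1 := by
    rw [← map_mul, Matrix.mul_nonsing_inv _ t.isUnit_det_gramT, map_one]
  rw [toSHom_gramT] at h1
  rw [← Matrix.inv_eq_right_inv h1]
  refine Matrix.inv_eq_right_inv ?_
  rw [Matrix.fromBlocks_multiply]
  simp [Matrix.mul_nonsing_inv _ S.isUnit_det_gram]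

lemma transpose_gramT : t.gramTᵀ = t.gramT := by
  rw [gramT, Matrix.transpose_mul, Matrix.transpose_transpose]

lemma transpose_inv_mul_inv : t.invJacobianᵀ * t.invJacobian = t.gramT⁻¹ := by
  rw [invJacobian, Matrix.transpose_mul, Matrix.transpose_transpose, Matrix.transpose_nonsing_inv,
    transpose_gramT, Matrix.mul_assoc, ← Matrix.mul_assoc t.jacobian]
  change t.gramT⁻¹ * (t.gramT * _) = _
  rw [Matrix.mul_nonsing_inv _ t.isUnit_det_gramT, Matrix.mul_one]

/-- The coefficients of the first order part of the Euclidean Laplacian on the tube. -/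
def driftT (i : Fin k ⊕ Fin d) : A t.T := ∑ m, t.euclid m (t.invJacobian m i)

lemma sum_euclid_euclid (f : A t.T) : ∑ m, t.euclid m (t.euclid m f) =
    ∑ i, ∑ j, t.gramT⁻¹ i j * pd t.T i (pd t.T j f) + ∑ i, t.driftT i * pd t.T i f := by
  have h1 : ∀ m, t.euclid m (t.euclid m f) =
      ∑ j, ∑ i, t.invJacobian m i * t.invJacobian m j * pd t.T i (pd t.T j f) +
        ∑ i, t.euclid m (t.invJacobian m i) * pd t.T i f := by
    intro m
    conv_lhs => rw [euclid_apply t m f]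
    rw [map_sum, ← Finset.sum_add_distrib]
    refine Finset.sum_congr rfl fun j _ => ?_
    rw [Derivation.leibniz, smul_eq_mul, smul_eq_mul, t.euclid_apply m (pd t.T j f), Finset.mul_sum,
      mul_comm (pd t.T j f)]
    congr 1
    exact Finset.sum_congr rfl fun i _ => by ring
  simp only [h1, Finset.sum_add_distrib]
  congr 1
  · rw [← transpose_inv_mul_inv]
    simp only [Matrix.mul_apply, Matrix.transpose_apply, Finset.sum_mul]
    rw [Finset.sum_comm]
    conv_rhs => rw [Finset.sum_comm]
    exact Finset.sum_congr rfl fun i _ => Finset.sum_comm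
  · simp only [driftT, Finset.sum_mul]
    rw [Finset.sum_comm]

/-- The first order part of the Laplacian is determined by the harmonicity of the Cartesian
coordinates. -/
lemma sum_driftT_mul_gramT (hn : k + d = n) (j : Fin k ⊕ Fin d) :
    ∑ i, t.driftT i * t.gramT i j =
      -∑ i, ∑ i', t.gramT⁻¹ i i' * ∑ m, pd t.T i (t.jacobian i' m) * t.jacobian j m := by
  have h1 : ∀ m, ∑ i, t.driftT i * t.jacobian i m =
      -∑ i, ∑ i', t.gramT⁻¹ i i' * pd t.T i (t.jacobian i' m) := by
    intro m
    have h2 := t.sum_euclid_euclid (t.cartesian m)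
    have h3 : ∀ l, t.euclid l (t.euclid l (t.cartesian m)) = 0 := by
      intro l
      rw [t.euclid_cartesian hn]
      split_ifs
      · exact Derivation.map_one_eq_zero _
      · exact map_zero _
    simp only [h3, Finset.sum_const_zero] at h2
    rw [eq_neg_iff_add_eq_zero, add_comm]
    exact h2.symm
  calc ∑ i, t.driftT i * t.gramT i j
      = ∑ m, (∑ i, t.driftT i * t.jacobian i m) * t.jacobian j m := by
        simp only [gramT, Matrix.mul_apply, Matrix.transpose_apply, Finset.mul_sum, Finset.sum_mul]
        rw [Finset.sum_comm]
        simp only [mul_assoc]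
    _ = _ := by
        simp only [h1, neg_mul, Finset.sum_neg_distrib, Finset.sum_mul, Finset.mul_sum]
        congr 1
        rw [Finset.sum_comm]
        refine Finset.sum_congr rfl fun i _ => ?_
        rw [Finset.sum_comm]
        simp only [mul_assoc]

lemma toSHom_pd_inl_jacobian (α β : Fin k) (m : Fin n) :
    t.toSHom (pd t.T (Sum.inl α) (t.jacobian (Sum.inl β) m)) =
      pd S.U α (pd S.U β (S.cartesian m)) := by
  rw [← pd_toSHom, toSHom_jacobian_inl]
  rfl

lemma pd_inr_jacobian_inr (a b : Fin d) (m : Fin n) :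
    pd t.T (Sum.inr a) (t.jacobian (Sum.inr b) m) = 0 := by
  rw [jacobian_inr, pd_inr_extend]

lemma toSHom_sum_driftT (hn : k + d = n) (j : Fin k ⊕ Fin d) :
    ∑ i, t.toSHom (t.driftT i) * t.toSHom (t.gramT i j) =
      -∑ α, ∑ β, S.gram⁻¹ α β * ∑ m, pd S.U α (pd S.U β (S.cartesian m)) *
        t.toSHom (t.jacobian j m) := by
  have h := congrArg t.toSHom (t.sum_driftT_mul_gramT hn j)
  have h2 : ∀ i j, t.toSHom (t.gramT⁻¹ i j) = Matrix.fromBlocks S.gram⁻¹ 0 0 1 i j :=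
    fun i j => congrFun (congrFun t.toSHom_inv_gramT i) j
  simp only [map_sum, map_add, map_mul, map_neg, h2, Fintype.sum_sum_type, Matrix.fromBlocks_apply₁₁,
    Matrix.fromBlocks_apply₁₂, Matrix.fromBlocks_apply₂₁,
    Matrix.zero_apply, zero_mul, Finset.sum_const_zero, add_zero, pd_inr_jacobian_inr,
    mul_zero, toSHom_pd_inl_jacobian] at h
  rw [Fintype.sum_sum_type]
  exact h

lemma toSHom_driftT_inr (hn : k + d = n) (a : Fin d) :
    t.toSHom (t.driftT (Sum.inr a)) = -t.meanTrace a := by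
  have h := t.toSHom_sum_driftT hn (Sum.inr a)
  have h2 : ∀ i j, t.toSHom (t.gramT i j) = Matrix.fromBlocks S.gram 0 0 1 i j :=
    fun i j => congrFun (congrFun t.toSHom_gramT i) j
  simp only [h2, Fintype.sum_sum_type, Matrix.fromBlocks_apply₁₂, Matrix.fromBlocks_apply₂₂,
    Matrix.zero_apply, mul_zero, Finset.sum_const_zero, zero_add, Matrix.one_apply, mul_ite,
    mul_one, Finset.sum_ite_eq', Finset.mem_univ, if_true, toSHom_jacobian_inr] at h
  exact h

lemma toSHom_driftT_inl (hn : k + d = n) (α : Fin k) :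
    t.toSHom (t.driftT (Sum.inl α)) = S.drift α := by
  refine congrFun (S.eq_drift (b := fun α => t.toSHom (t.driftT (Sum.inl α))) fun γ => ?_) α
  have h := t.toSHom_sum_driftT hn (Sum.inl γ)
  have h2 : ∀ i j, t.toSHom (t.gramT i j) = Matrix.fromBlocks S.gram 0 0 1 i j :=
    fun i j => congrFun (congrFun t.toSHom_gramT i) j
  simp only [h2, Fintype.sum_sum_type, Matrix.fromBlocks_apply₁₁, Matrix.fromBlocks_apply₂₁,
    Matrix.zero_apply, mul_zero, Finset.sum_const_zero, add_zero, toSHom_jacobian_inl] at h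
  exact h

/-- The Euclidean Laplacian along the zero section. -/
lemma toSHom_sum_euclid_euclid (hn : k + d = n) (f : A t.T) :
    t.toSHom (∑ m, t.euclid m (t.euclid m f)) =
      (secondOrder S.gram⁻¹ S.drift 0).app (t.toSHom f) +
        ∑ a, (t.toSHom (pd t.T (Sum.inr a) (pd t.T (Sum.inr a) f)) -
          t.meanTrace a * t.toSHom (pd t.T (Sum.inr a) f)) := by
  have h2 : ∀ i j, t.toSHom (t.gramT⁻¹ i j) = Matrix.fromBlocks S.gram⁻¹ 0 0 1 i j :=
    fun i j => congrFun (congrFun t.toSHom_inv_gramT i) j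
  rw [sum_euclid_euclid, secondOrder_app]
  simp only [map_add, map_sum, map_mul, Fintype.sum_sum_type, h2, Matrix.fromBlocks_apply₁₁,
    Matrix.fromBlocks_apply₁₂, Matrix.fromBlocks_apply₂₁, Matrix.fromBlocks_apply₂₂,
    Matrix.zero_apply, zero_mul, Finset.sum_const_zero, add_zero, zero_add, Matrix.one_apply,
    ite_mul, one_mul, Finset.sum_ite_eq, Finset.mem_univ, if_true, t.toSHom_driftT_inr hn,
    t.toSHom_driftT_inl hn, pd_toSHom, neg_mul, Finset.sum_sub_distrib, Finset.sum_neg_distrib]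
  ring

end Tube

/-! ### The volume element of a tube -/

lemma det_mul_transpose_sq {R ι κ : Type*} [CommRing R] [Fintype ι] [Fintype κ] [DecidableEq ι]
    [DecidableEq κ] (e : ι ≃ κ) (M N : Matrix ι κ R) :
    (M * Nᵀ).det ^ 2 = (M * Mᵀ).det * (N * Nᵀ).det := by
  have h : ∀ M N : Matrix ι κ R, M * Nᵀ = M.submatrix id e * (N.submatrix id e)ᵀ := fun M N => by
    rw [Matrix.transpose_submatrix, Matrix.submatrix_mul_equiv, Matrix.submatrix_id_id]
  rw [h M N, h M M, h N N]
  simp only [Matrix.det_mul, Matrix.det_transpose]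
  ring

lemma Patch.adjugate_gram {k n : ℕ} (S : Patch k n) (α β : Fin k) :
    S.gram.adjugate α β = S.gram.det * S.gram⁻¹ α β := by
  have h : S.gram.adjugate = S.gram.det • S.gram⁻¹ := by
    rw [← Matrix.mul_one S.gram.adjugate, ← Matrix.mul_nonsing_inv _ S.isUnit_det_gram,
      ← Matrix.mul_assoc, Matrix.adjugate_mul, Matrix.smul_mul, Matrix.one_mul]
  rw [h, Matrix.smul_apply, smul_eq_mul]

lemma Patch.inv_gram_symm {k n : ℕ} (S : Patch k n) (α β : Fin k) :
    S.gram⁻¹ α β = S.gram⁻¹ β α := by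
  conv_lhs => rw [← S.transpose_gram, ← Matrix.transpose_nonsing_inv]
  rfl

namespace Tube

variable {k n d : ℕ} {S : Patch k n} (t : Tube S d)

/-- The matrix `g - ∑ q^a h_a` of the inner products `⟪∂_α X, ∂_β Φ⟫`. -/
def offsetGram : Matrix (Fin k) (Fin k) (A t.T) :=
  .of fun α β => t.extend (S.gram α β) -
    ∑ a, A.coord t.T (Sum.inr a) * t.extend (t.secondForm a α β)

/-- The Jacobian matrix of `Φ` along the zero section, extended independently of `q`. -/
def baseFrame : Matrix (Fin k ⊕ Fin d) (Fin n) (A t.T) :=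
  .of fun i m => Sum.elim (fun α => t.extend (S.jacobian α m)) (fun a => t.extend (t.normalFrame a m)) i

lemma baseFrame_mul_transpose : t.baseFrame * t.baseFrameᵀ =
    Matrix.fromBlocks (t.extend.mapMatrix S.gram) 0 0 1 := by
  have h1 := fun α a => congrFun (congrFun t.jacobian_mul_normalFrame α) a
  have h2 := fun a b => congrFun (congrFun t.normalFrame_mul_transpose a) b
  simp only [Matrix.mul_apply, Matrix.transpose_apply] at h1 h2
  refine Matrix.ext fun i j => ?_
  rw [Matrix.mul_apply]
  rcases i with α | a <;> rcases j with β | b <;>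
    simp only [baseFrame, Matrix.transpose_apply, Matrix.of_apply, Sum.elim_inl, Sum.elim_inr,
      ← map_mul, ← map_sum, Matrix.fromBlocks_apply₁₁, Matrix.fromBlocks_apply₁₂,
      Matrix.fromBlocks_apply₂₁, Matrix.fromBlocks_apply₂₂]
  · rfl
  · rw [h1]; simp
  · simp only [mul_comm (t.normalFrame _ _)]
    rw [h1]; simp
  · rw [h2, Matrix.one_apply, Matrix.one_apply]
    split_ifs <;> simp

lemma det_baseFrame_mul_jacobian :
    (t.baseFrame * t.jacobianᵀ).det = t.offsetGram.det := by
  have h1 := fun α a => congrFun (congrFun t.jacobian_mul_normalFrame α) a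
  have h2 := fun a b => congrFun (congrFun t.normalFrame_mul_transpose a) b
  simp only [Matrix.mul_apply, Matrix.transpose_apply] at h1 h2
  have h : t.baseFrame * t.jacobianᵀ = Matrix.fromBlocks t.offsetGram 0
      (.of fun a β => (t.baseFrame * t.jacobianᵀ) (Sum.inr a) (Sum.inl β)) 1 := by
    refine Matrix.ext fun i j => ?_
    rcases i with α | a <;> rcases j with β | b <;>
      simp only [Matrix.fromBlocks_apply₁₁, Matrix.fromBlocks_apply₁₂,
        Matrix.fromBlocks_apply₂₁, Matrix.fromBlocks_apply₂₂, Matrix.of_apply] <;>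
      simp only [Matrix.mul_apply, Matrix.transpose_apply, baseFrame, Matrix.of_apply, Sum.elim_inl,
        Sum.elim_inr, jacobian_inl, jacobian_inr, ← map_mul, ← map_sum]
    · simp only [offsetGram, Matrix.of_apply, mul_add, Finset.sum_add_distrib, ← map_mul,
        ← map_sum, Finset.mul_sum]
      rw [Finset.sum_comm, sub_eq_add_neg, ← Finset.sum_neg_distrib]
      congr 1
      refine Finset.sum_congr rfl fun a _ => ?_
      simp only [mul_left_comm _ (A.coord t.T (Sum.inr a)), ← Finset.mul_sum, ← map_mul, ← map_sum]
      rw [t.sum_jacobian_mul_pd_normalFrame, map_neg, mul_neg]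
    · rw [h1]; simp
    · rw [h2, Matrix.one_apply, Matrix.one_apply]
      split_ifs <;> simp
  rw [h, Matrix.det_fromBlocks_zero₁₂, Matrix.det_one, mul_one]

/-- The volume element of the tube, in terms of the two fundamental forms. -/
lemma extend_det_mul_halfForm (hn : k + d = n) :
    t.extend S.gram.det * (t.halfForm : A t.T) ^ 4 = t.offsetGram.det ^ 2 := by
  have e : Fin k ⊕ Fin d ≃ Fin n := finSumFinEquiv.trans (finCongr hn)
  rw [← det_baseFrame_mul_jacobian, det_mul_transpose_sq e, baseFrame_mul_transpose,
    Matrix.det_fromBlocks_zero₁₂, Matrix.det_one, mul_one, ← det_gramT, AlgHom.map_det]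
  rfl

lemma toSHom_offsetGram : t.toSHom.mapMatrix t.offsetGram = S.gram := by
  refine Matrix.ext fun α β => ?_
  change t.toSHom (t.offsetGram α β) = _
  simp [offsetGram, toSHom_extend, toSHom_coord]

lemma toSHom_det_offsetGram : t.toSHom t.offsetGram.det = S.gram.det := by
  rw [AlgHom.map_det, toSHom_offsetGram]

lemma pd_inr_offsetGram (a : Fin d) (α β : Fin k) :
    pd t.T (Sum.inr a) (t.offsetGram α β) = -t.extend (t.secondForm a α β) := by
  rw [offsetGram, Matrix.of_apply, map_sub, map_sum, pd_inr_extend]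
  simp only [pd_mul, pd_inr_extend, pd_coord, Sum.inr.injEq, mul_zero, zero_add, mul_ite, mul_one,
    Finset.sum_ite_eq, Finset.mem_univ, if_true, zero_sub]

lemma secondForm_symm (a : Fin d) (α β : Fin k) : t.secondForm a α β = t.secondForm a β α := by
  simp only [secondForm, Matrix.of_apply, pd_comm α β]

lemma toSHom_pd_det_offsetGram (a : Fin d) :
    t.toSHom (pd t.T (Sum.inr a) t.offsetGram.det) = -(S.gram.det * t.meanTrace a) := by
  rw [← pdDer_apply, derivation_det]
  have h : ∀ i j, t.toSHom (t.offsetGram.adjugate i j) = S.gram.adjugate i j := by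
    intro i j
    have := congrFun (congrFun (AlgHom.map_adjugate t.toSHom t.offsetGram) i) j
    rwa [toSHom_offsetGram] at this
  simp only [map_sum, map_mul, h, pdDer_apply, pd_inr_offsetGram, map_neg, toSHom_extend,
    S.adjugate_gram, meanTrace, Finset.mul_sum, mul_neg, Finset.sum_neg_distrib]
  congr 1
  refine Finset.sum_congr rfl fun i _ => Finset.sum_congr rfl fun j _ => ?_
  rw [t.secondForm_symm a j i, mul_assoc]

/-- The function `g_T^{-1/4} ∂_a² g_T^{1/4}` on the zero section. -/
def potential (a : Fin d) : A S.U :=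
  t.toSHom (↑t.halfForm⁻¹ * pd t.T (Sum.inr a) (pd t.T (Sum.inr a) ↑t.halfForm))

lemma toSHom_halfForm_pow : t.toSHom (t.halfForm : A t.T) ^ 4 = S.gram.det := by
  rw [← map_pow, ← det_gramT, AlgHom.map_det, toSHom_gramT, Matrix.det_fromBlocks_zero₁₂,
    Matrix.det_one, mul_one]

lemma eval_halfForm_ne_zero (x : S.U) : A.eval x (t.toSHom (t.halfForm : A t.T)) ≠ 0 :=
  ((t.halfForm.isUnit.map t.toSHom).map (A.eval x)).ne_zero

lemma two_mul_pd_halfForm (hn : k + d = n) (a : Fin d) :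
    2 * t.toSHom (pd t.T (Sum.inr a) (t.halfForm : A t.T)) =
      -(t.toSHom (t.halfForm : A t.T) * t.meanTrace a) := by
  have h1 := congrArg (fun f => t.toSHom (pdDer t.T (Sum.inr a) f)) (t.extend_det_mul_halfForm hn)
  simp only [Derivation.leibniz, Derivation.leibniz_pow, smul_eq_mul, nsmul_eq_mul, map_mul,
    map_pow, pdDer_apply, pd_inr_extend, toSHom_pd_det_offsetGram, toSHom_det_offsetGram,
    toSHom_extend, mul_zero, add_zero, map_natCast] at h1
  refine A.ext_eval fun x => ?_
  have h2 := congrArg (A.eval x) h1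
  have h3 := congrArg (A.eval x) t.toSHom_halfForm_pow
  have hg := S.isUnit_det_gram.map (A.eval x) |>.ne_zero
  have hw := t.eval_halfForm_ne_zero x
  simp only [map_mul, map_pow, map_neg, map_natCast, map_ofNat] at h2 h3 ⊢
  refine mul_left_cancel₀ (mul_ne_zero hg (pow_ne_zero 3 hw)) ?_
  push_cast at h2
  linear_combination h2 / 2 + A.eval x S.gram.det * A.eval x (t.meanTrace a) * h3

lemma det_mul_potential (hn : k + d = n) (a : Fin d) :
    4 * S.gram.det * t.potential a =
      2 * t.toSHom (pd t.T (Sum.inr a) (pd t.T (Sum.inr a) t.offsetGram.det)) -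
        S.gram.det * t.meanTrace a ^ 2 := by
  have h1 := congrArg (fun f => t.toSHom (pdDer t.T (Sum.inr a) (pdDer t.T (Sum.inr a) f)))
    (t.extend_det_mul_halfForm hn)
  have h0 : pdDer t.T (Sum.inr a) (t.extend S.gram.det) = 0 := t.pd_inr_extend a _
  simp only [Derivation.leibniz, Derivation.leibniz_pow, smul_eq_mul, nsmul_eq_mul, map_add, map_mul,
    map_pow, h0, mul_zero, add_zero, map_natCast, Derivation.map_natCast] at h1
  simp only [pdDer_apply, toSHom_pd_det_offsetGram, toSHom_det_offsetGram, toSHom_extend] at h1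
  refine A.ext_eval fun x => ?_
  have h2 := congrArg (A.eval x) h1
  have h3 := congrArg (A.eval x) t.toSHom_halfForm_pow
  have h4 := congrArg (A.eval x) (t.two_mul_pd_halfForm hn a)
  have h5 := congrArg (fun f => A.eval x (t.toSHom f)) t.halfForm.mul_inv
  have hg := S.isUnit_det_gram.map (A.eval x) |>.ne_zero
  have hw := t.eval_halfForm_ne_zero x
  rw [potential]
  simp only [map_mul, map_pow, map_neg, map_natCast, map_ofNat, map_add, map_sub, map_one] at h2 h3 h4 h5 ⊢
  push_cast at h2
  generalize A.eval x (t.toSHom (t.halfForm : A t.T)) = w at *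
  generalize A.eval x (t.toSHom (↑t.halfForm⁻¹ : A t.T)) = wi at *
  generalize A.eval x (t.toSHom (pd t.T (Sum.inr a) (t.halfForm : A t.T))) = w1 at *
  generalize A.eval x (t.toSHom (pd t.T (Sum.inr a) (pd t.T (Sum.inr a) (t.halfForm : A t.T)))) =
    w2 at *
  generalize A.eval x S.gram.det = g at *
  generalize A.eval x (t.meanTrace a) = H at *
  obtain rfl : w1 = -(w * H) / 2 := by linear_combination h4 / 2
  refine mul_left_cancel₀ hg ?_
  linear_combination h2 + (-4 * g * w2 * wi - 3 * g * H ^ 2) * h3 + 4 * g * w2 * w ^ 3 * h5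

/-! ### Normal connections along the zero section -/

lemma nabla_apply (a : Fin d) (f : A t.T) :
    t.nabla a f = ↑t.halfForm⁻¹ * pd t.T (Sum.inr a) (↑t.halfForm * f) := rfl

lemma nabla_nabla (a : Fin d) (f : A t.T) : t.nabla a (t.nabla a f) =
    ↑t.halfForm⁻¹ * pd t.T (Sum.inr a) (pd t.T (Sum.inr a) (↑t.halfForm * f)) := by
  rw [nabla_apply, nabla_apply, Units.mul_inv_cancel_left]

lemma toSHom_nabla_nabla (hn : k + d = n) (a : Fin d) (f : A t.T) :
    t.toSHom (t.nabla a (t.nabla a f)) =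
      t.toSHom (pd t.T (Sum.inr a) (pd t.T (Sum.inr a) f)) -
        t.meanTrace a * t.toSHom (pd t.T (Sum.inr a) f) + t.potential a * t.toSHom f := by
  have h1 := t.two_mul_pd_halfForm hn a
  have h2 : t.toSHom ↑t.halfForm⁻¹ * t.toSHom ↑t.halfForm = 1 := by
    rw [← map_mul, Units.inv_mul, map_one]
  rw [nabla_nabla, potential]
  simp only [pd_mul, map_add, map_mul]
  linear_combination t.toSHom ↑t.halfForm⁻¹ * t.toSHom (pd t.T (Sum.inr a) f) * h1 +
    (t.toSHom (pd t.T (Sum.inr a) (pd t.T (Sum.inr a) f)) -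
      t.meanTrace a * t.toSHom (pd t.T (Sum.inr a) f)) * h2

lemma prod_ofFn_eq {M : Type*} [Monoid M] {d : ℕ} {f : Fin d → M} {a : Fin d}
    (h : ∀ b, b ≠ a → f b = 1) : (List.ofFn f).prod = f a := by
  induction d with
  | zero => exact a.elim0
  | succ d ih =>
    rw [List.ofFn_succ, List.prod_cons]
    cases a using Fin.cases with
    | zero =>
      rw [List.prod_eq_one, mul_one]
      intro x hx
      obtain ⟨i, rfl⟩ := (List.mem_ofFn' _ _).1 hx
      exact h _ (Fin.succ_ne_zero i)
    | succ a =>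
      rw [h 0 (Fin.succ_ne_zero a).symm, one_mul]
      exact ih fun b hb => h _ (by simpa using hb)

lemma nablaPow_zero : t.nablaPow 0 = 1 := by
  rw [nablaPow, List.prod_eq_one]
  intro x hx
  obtain ⟨i, rfl⟩ := (List.mem_ofFn' _ _).1 hx
  simp

lemma nablaPow_single (a : Fin d) (m : ℕ) : t.nablaPow (Finsupp.single a m) = t.nabla a ^ m := by
  rw [nablaPow, prod_ofFn_eq (a := a)]
  · rw [Finsupp.single_eq_same]
  · intro b hb
    rw [Finsupp.single_eq_of_ne hb, pow_zero]

lemma prod_ofFn_pow_apply_eq_zero {M : Type*} [AddCommGroup M] [Module ℂ M] {d : ℕ}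
    {F : Fin d → Module.End ℂ M} {γ : Fin d → ℕ} {v : M} (hF : ∀ a, F a v = 0) (hγ : γ ≠ 0) :
    (List.ofFn fun a => F a ^ γ a).prod v = 0 := by
  induction d with
  | zero => exact absurd (Subsingleton.elim _ _) hγ
  | succ d ih =>
    rw [List.ofFn_succ, List.prod_cons, Module.End.mul_apply]
    by_cases h : (fun a : Fin d => γ a.succ) = 0
    · have h0 : γ 0 ≠ 0 := fun h0 => hγ <| funext fun a => by
        cases a using Fin.cases with
        | zero => exact h0
        | succ a => exact congrFun h a
      obtain ⟨m, hm⟩ := Nat.exists_eq_succ_of_ne_zero h0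
      rw [List.prod_eq_one, Module.End.one_apply, hm, Nat.succ_eq_add_one, pow_succ,
        Module.End.mul_apply, hF, map_zero]
      intro x hx
      obtain ⟨i, rfl⟩ := (List.mem_ofFn' _ _).1 hx
      have hi : γ i.succ = 0 := congrFun h i
      change F i.succ ^ γ i.succ = 1
      rw [hi, pow_zero]
    · rw [ih (F := fun a => F a.succ) (γ := fun a => γ a.succ) (fun a => hF _) h, map_zero]

lemma nablaPow_eq_zero {f : A t.T} (hf : ∀ a, t.nabla a f = 0) {γ : Fin d →₀ ℕ} (hγ : γ ≠ 0) :
    t.nablaPow γ f = 0 :=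
  prod_ofFn_pow_apply_eq_zero hf fun h => hγ (DFunLike.coe_injective h)

/-! ### The standard form of the Schrödinger operator -/

/-- The operator `Δ_S - ∑ g_T^{-1/4} ∂_a² g_T^{1/4}` on the submanifold. -/
def submanifoldOperator : D S.U := secondOrder S.gram⁻¹ S.drift (-∑ a, t.potential a)

/-- The standard form `-L - ∑ ∇_a²` of the Schrödinger operator of the tube. -/
def standardForm : DST S d :=
  AddMonoidAlgebra.single 0 (-t.submanifoldOperator) -
    ∑ a, AddMonoidAlgebra.single (Finsupp.single a 2) 1

/-- The action of a standard form on functions on the tube. -/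
def standardAction (f : A t.T) : DST S d →+ A S.U :=
  (Finsupp.liftAddHom fun γ => (LinearMap.applyₗ (R := ℂ) (t.toS (t.nablaPow γ f))).toAddMonoidHom.comp
    (D.appHom (U := S.U)).toAddMonoidHom).comp AddMonoidAlgebra.coeffAddEquiv.toAddMonoidHom

lemma standardAction_apply (f : A t.T) (R : DST S d) :
    t.standardAction f R = R.coeff.sum fun γ Q => Q.app (t.toS (t.nablaPow γ f)) := rfl

lemma standardAction_single (f : A t.T) (γ : Fin d →₀ ℕ) (Q : D S.U) :
    t.standardAction f (AddMonoidAlgebra.single γ Q) = Q.app (t.toS (t.nablaPow γ f)) := by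
  rw [standardAction_apply, AddMonoidAlgebra.coeff_single]
  exact Finsupp.sum_single_index rfl

lemma isRestriction_standardForm (hn : k + d = n) :
    t.IsRestriction t.schrodinger t.standardForm := by
  intro f
  rw [← standardAction_apply, standardForm, map_sub, map_sum]
  simp only [standardAction_single, nablaPow_zero, nablaPow_single, pow_two, D.app_one,
    Module.End.one_apply, Module.End.mul_apply, ← toSHom_apply, t.toSHom_nabla_nabla hn,
    schrodinger_app, map_neg, t.toSHom_sum_euclid_euclid hn, D.app_neg, LinearMap.neg_apply,
    submanifoldOperator, secondOrder_app, Finset.sum_add_distrib, Finset.sum_mul, neg_mul, zero_mul]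
  ring

lemma IsRestriction.coeff_zero_app {P : D t.T} {R : DST S d} (h : t.IsRestriction P R)
    (φ : A S.U) : D.app (R.coeff 0) φ =
      t.toS (P.app (↑t.halfForm⁻¹ * t.extend (t.toSHom ↑t.halfForm * φ))) := by
  set f : A t.T := ↑t.halfForm⁻¹ * t.extend (t.toSHom ↑t.halfForm * φ) with hf
  have h1 : ∀ a, t.nabla a f = 0 := fun a => by
    rw [nabla_apply, hf, Units.mul_inv_cancel_left, pd_inr_extend, mul_zero]
  have h2 : t.toS f = φ := by
    rw [← toSHom_apply, hf, map_mul, toSHom_extend, ← mul_assoc, ← map_mul, Units.inv_mul, map_one,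
      one_mul]
  rw [h f, Finsupp.sum, Finset.sum_eq_single 0]
  · rw [nablaPow_zero, Module.End.one_apply, h2]
  · intro γ _ hγ
    rw [t.nablaPow_eq_zero h1 hγ, map_zero, map_zero]
  · intro h0
    rw [Finsupp.notMem_support_iff.1 h0]
    rfl

/-- The part without normal connections of every restriction of the Schrödinger operator. -/
lemma coeff_zero_of_isSchrodinger (hn : k + d = n) {P : D t.T} {R : DST S d}
    (hP : t.IsSchrodinger P) (hR : t.IsRestriction P R) : R.coeff 0 = -t.submanifoldOperator := by
  obtain rfl := hP.eq t hn (t.isSchrodinger_schrodinger hn)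
  have h : t.standardForm.coeff 0 = -t.submanifoldOperator := by
    rw [standardForm, AddMonoidAlgebra.coeff_sub, AddMonoidAlgebra.coeff_sum]
    simp
  rw [← h]
  refine D.ext fun φ x => ?_
  rw [hR.coeff_zero_app, (t.isRestriction_standardForm hn).coeff_zero_app]

end Tube

namespace Tube

variable {k n d : ℕ} {S : Patch k n} (t : Tube S d)

/-! ### The submanifold Schrödinger system -/

/-- The homomorphism `∇_a ↦ 0` on standard forms. -/
def constantTerm (S : Patch k n) (d : ℕ) : DST S d →+* D S.U where
  toFun R := R.coeff 0
  map_zero' := rfl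
  map_add' _ _ := rfl
  map_one' := by simp [AddMonoidAlgebra.one_def]
  map_mul' R R' := by
    induction R using AddMonoidAlgebra.induction_linear with
    | zero => simp
    | add f g hf hg => rw [add_mul, AddMonoidAlgebra.coeff_add, Finsupp.add_apply, hf, hg,
        AddMonoidAlgebra.coeff_add, Finsupp.add_apply, add_mul]
    | single m r =>
      induction R' using AddMonoidAlgebra.induction_linear with
      | zero => simp
      | add f g hf hg => rw [mul_add, AddMonoidAlgebra.coeff_add, Finsupp.add_apply, hf, hg,
          AddMonoidAlgebra.coeff_add, Finsupp.add_apply, mul_add]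
      | single m' r' =>
        simp only [AddMonoidAlgebra.single_mul_single, AddMonoidAlgebra.coeff_single,
          Finsupp.single_apply, add_eq_zero]
        by_cases h : m = 0 <;> by_cases h' : m' = 0 <;> simp [h, h']

lemma constantTerm_apply (R : DST S d) : constantTerm S d R = R.coeff 0 := rfl

lemma constantTerm_single_zero (P : D S.U) :
    constantTerm S d (AddMonoidAlgebra.single 0 P) = P := by
  simp [constantTerm_apply]

lemma constantTerm_var (a : Fin d) : constantTerm S d (var a) = 0 := by
  simp [constantTerm_apply, var]

lemma exists_eq_single_add (R : DST S d) :
    ∃ Q : Fin d → DST S d, R = AddMonoidAlgebra.single 0 (constantTerm S d R) + ∑ a, Q a * var a := by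
  induction R using AddMonoidAlgebra.induction_linear with
  | zero => exact ⟨0, by simp⟩
  | add f g hf hg =>
    obtain ⟨Q, hQ⟩ := hf
    obtain ⟨Q', hQ'⟩ := hg
    refine ⟨Q + Q', ?_⟩
    conv_lhs => rw [hQ, hQ']
    simp only [map_add, AddMonoidAlgebra.single_add, Pi.add_apply, add_mul, Finset.sum_add_distrib]
    abel
  | single m r =>
    by_cases h : m = 0
    · exact ⟨0, by simp [h, constantTerm_apply]⟩
    · obtain ⟨a, ha⟩ : ∃ a, m a ≠ 0 := by
        by_contra! h'
        exact h (Finsupp.ext h')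
      refine ⟨Pi.single a (AddMonoidAlgebra.single (m - Finsupp.single a 1) r), ?_⟩
      rw [Finset.sum_eq_single a (fun b _ hb => by rw [Pi.single_eq_of_ne hb, zero_mul]) (by simp),
        Pi.single_eq_same, var, AddMonoidAlgebra.single_mul_single, mul_one,
        tsub_add_cancel_of_le (Finsupp.single_le_iff.2 (Nat.one_le_iff_ne_zero.2 ha))]
      simp [constantTerm_apply, h]

lemma constantTerm_mem (hn : k + d = n) {R : DST S d} (hR : R ∈ t.schrodingerIdeal) :
    ∃ Q : D S.U, constantTerm S d R = Q * -t.submanifoldOperator := by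
  induction hR using Submodule.span_induction with
  | mem R h =>
    obtain ⟨P, hP, hR⟩ := h
    exact ⟨1, by rw [one_mul]; exact t.coeff_zero_of_isSchrodinger hn hP hR⟩
  | zero => exact ⟨0, by simp⟩
  | add R R' _ _ h h' =>
    obtain ⟨Q, hQ⟩ := h
    obtain ⟨Q', hQ'⟩ := h'
    exact ⟨Q + Q', by rw [map_add, hQ, hQ', add_mul]⟩
  | smul a R _ h =>
    obtain ⟨Q, hQ⟩ := h
    exact ⟨constantTerm S d a * Q, by rw [smul_eq_mul, map_mul, hQ, mul_assoc]⟩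

lemma etaConf_mk (Q : Fin d → DST S d) :
    t.etaConf (fun a => t.schrodingerIdeal.mkQ (Q a)) =
      t.schrodingerIdeal.mkQ (∑ a, Q a * var a) := by
  rw [etaConf, LinearMap.sum_apply, map_sum]
  refine Finset.sum_congr rfl fun a _ => ?_
  rw [LinearMap.comp_apply, LinearMap.proj_apply, eta, Submodule.mkQ_apply, Submodule.mapQ_apply]
  rfl

/-- The projection of the ring of standard forms to the submanifold Schrödinger system. -/
def toSystem : DST S d →ₗ[DST S d] t.SubmanifoldSystem :=
  LinearMap.comp (M₃ := t.SystemST ⧸ LinearMap.range t.etaConf) (LinearMap.range t.etaConf).mkQ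
    t.schrodingerIdeal.mkQ

lemma toSystem_surjective : Function.Surjective t.toSystem :=
  (LinearMap.range t.etaConf).mkQ_surjective.comp t.schrodingerIdeal.mkQ_surjective

lemma smul_generator (P : D S.U) :
    P • t.generator = t.toSystem (AddMonoidAlgebra.single 0 P) := by
  have h : (AddMonoidAlgebra.single 0 P : DST S d) =
      (AddMonoidAlgebra.single 0 P : DST S d) • (1 : DST S d) := by
    rw [smul_eq_mul, mul_one]
  rw [h, map_smul]
  rfl

lemma toSystem_eq_zero_iff (R : DST S d) :
    t.toSystem R = 0 ↔ ∃ Q : Fin d → DST S d, R - ∑ a, Q a * var a ∈ t.schrodingerIdeal := by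
  change (LinearMap.range t.etaConf).mkQ (t.schrodingerIdeal.mkQ R) = 0 ↔ _
  rw [Submodule.mkQ_apply, Submodule.Quotient.mk_eq_zero, LinearMap.mem_range]
  constructor
  · rintro ⟨q, hq⟩
    choose Q hQ using fun a => t.schrodingerIdeal.mkQ_surjective (q a)
    obtain rfl : q = fun a => t.schrodingerIdeal.mkQ (Q a) := funext fun a => (hQ a).symm
    rw [etaConf_mk] at hq
    exact ⟨Q, (Submodule.Quotient.eq _).1 hq.symm⟩
  · rintro ⟨Q, hQ⟩
    refine ⟨fun a => t.schrodingerIdeal.mkQ (Q a), ?_⟩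
    rw [etaConf_mk]
    exact ((Submodule.Quotient.eq _).2 hQ).symm

lemma smul_generator_surjective : Function.Surjective fun P : D S.U => P • t.generator := by
  intro z
  obtain ⟨R, rfl⟩ := t.toSystem_surjective z
  obtain ⟨Q, hQ⟩ := exists_eq_single_add R
  refine ⟨constantTerm S d R, ?_⟩
  change _ • t.generator = _
  rw [smul_generator, eq_comm, ← sub_eq_zero, ← map_sub, toSystem_eq_zero_iff]
  refine ⟨Q, ?_⟩
  have h : R - AddMonoidAlgebra.single 0 (constantTerm S d R) - ∑ a, Q a * var a = 0 := by
    rw [sub_sub, sub_eq_zero]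
    exact hQ
  rw [h]
  exact Submodule.zero_mem _

/-- The system is the quotient of the differential operators on `S` by the left ideal of `-L`. -/
lemma smul_generator_eq_zero_iff (hn : k + d = n) (P : D S.U) :
    P • t.generator = 0 ↔ ∃ Q, Q * -t.submanifoldOperator = P := by
  constructor
  · rw [smul_generator, toSystem_eq_zero_iff]
    rintro ⟨Q, hQ⟩
    obtain ⟨Q', hQ'⟩ := t.constantTerm_mem hn hQ
    refine ⟨Q', ?_⟩
    rw [← hQ', map_sub, constantTerm_single_zero, map_sum]
    simp [constantTerm_var]
  · rintro ⟨Q, rfl⟩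
    have h : (-t.submanifoldOperator) • t.generator = 0 := by
      rw [smul_generator, toSystem_eq_zero_iff]
      refine ⟨var, ?_⟩
      have h1 : AddMonoidAlgebra.single 0 (-t.submanifoldOperator) -
          ∑ a, var (S := S) a * var a = t.standardForm := by
        rw [standardForm]
        congr 1
        refine Finset.sum_congr rfl fun a _ => ?_
        rw [var, AddMonoidAlgebra.single_mul_single, ← Finsupp.single_add, one_mul]
      rw [h1]
      exact Submodule.subset_span ⟨_, t.isSchrodinger_schrodinger hn,
        t.isRestriction_standardForm hn⟩
    rw [mul_smul, h, smul_zero]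

/-- The submanifold Schrödinger operator is unique, since two such operators differ by a function
and generate the same left ideal. -/
lemma isSubmanifoldSchrodingerOperator_iff [NeZero k] (hn : k + d = n)
    (hprin : ∃ f : A S.U, ∀ (ψ : A S.U) (x : S.U),
      t.submanifoldOperator.app ψ x = S.beltramiLaplace ψ x + f x * ψ x) (L : D S.U) :
    t.IsSubmanifoldSchrodingerOperator L ↔ L = t.submanifoldOperator := by
  have key : ∀ P : D S.U, ad (mult S.U (A.coord S.U 0)) (P * t.submanifoldOperator).app = 0 →
      P = 0 := fun P hP =>
    eq_zero_of_commute_mul_secondOrder 0 (S.isUnit_inv_gram_diag 0) _ _ P hP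
  constructor
  · intro hL
    obtain ⟨f, hf⟩ := hprin
    obtain ⟨f', hf'⟩ := hL.principal
    have h1 : L = t.submanifoldOperator + D.mult (f' - f) := by
      refine D.ext fun ψ x => ?_
      rw [hf', D.app_add]
      change _ = t.submanifoldOperator.app ψ x + (f' x - f x) * ψ x
      rw [hf]
      ring
    have h2 : (-L) • t.generator = 0 := by
      have := (hL.exact (-L)).2 ⟨1, by rw [LinearMap.toSpanSingleton_apply, one_smul]⟩
      rwa [LinearMap.toSpanSingleton_apply] at this
    obtain ⟨Q, hQ⟩ := (t.smul_generator_eq_zero_iff hn _).1 h2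
    have h3 : (Q - 1) * t.submanifoldOperator = D.mult (f' - f) := by
      rw [mul_neg, neg_inj] at hQ
      rw [sub_mul, one_mul, hQ, h1]
      abel
    have h4 : Q - 1 = 0 := by
      refine key _ ?_
      rw [h3]
      exact ad_mult_mult _ _
    rw [h4, zero_mul] at h3
    rw [h1, ← h3, add_zero]
  · rintro rfl
    refine ⟨hprin, ?_, ?_, t.smul_generator_surjective⟩
    · rw [← LinearMap.ker_eq_bot, LinearMap.ker_eq_bot']
      intro P hP
      rw [LinearMap.toSpanSingleton_apply, smul_eq_mul, mul_neg, neg_eq_zero] at hP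
      refine key P ?_
      rw [hP]
      exact map_zero _
    · intro P
      exact t.smul_generator_eq_zero_iff hn P

end Tube

/-! ### The Beltrami-Laplace operator -/

namespace Patch

variable {k n : ℕ} (S : Patch k n)

lemma analyticAt_sqrt_det (x : S.U) :
    AnalyticAt ℝ (fun y => ((Real.sqrt (S.metric y).det : ℝ) : ℂ)) x := by
  have hp := (S.posDef_metric x).det_pos
  have hdet : AnalyticAt ℝ (fun y => (S.metric y).det) x := by
    simp only [Matrix.det_apply]
    refine Finset.analyticAt_fun_sum _ fun σ _ => ?_
    simp only [Units.smul_def, zsmul_eq_mul]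
    refine analyticAt_const.mul (Finset.analyticAt_fun_prod _ fun i _ => ?_)
    simp only [metric, Matrix.gram_apply]
    exact ((innerSL ℝ).analyticAt_bilinear _).comp₂
      (analyticAt_partialDeriv _ (S.analytic x x.2)) (analyticAt_partialDeriv _ (S.analytic x x.2))
  have h : AnalyticAt ℝ (fun y => Real.exp (Real.log (S.metric y).det * (1 / 2))) x :=
    (((analyticAt_log hp).comp_of_eq hdet rfl).mul analyticAt_const).rexp'
  refine (analyticAt_ofReal h).congr ?_
  filter_upwards [hdet.continuousAt.eventually (lt_mem_nhds hp)] with y hy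
  rw [Real.sqrt_eq_rpow, Real.rpow_def_of_pos hy]

/-- The volume element of the induced metric. -/
def volumeElement : A S.U := A.of S.U _ S.analyticAt_sqrt_det

lemma volumeElement_sq : S.volumeElement ^ 2 = S.gram.det := by
  refine A.ext_eval fun x => ?_
  rw [eval_det_gram, map_pow, volumeElement, A.eval_of, ← Complex.ofReal_pow,
    Real.sq_sqrt (S.posDef_metric x).det_pos.le]

lemma isUnit_volumeElement : IsUnit S.volumeElement :=
  (isUnit_pow_iff two_ne_zero).1 (S.volumeElement_sq ▸ S.isUnit_det_gram)

/-- The contracted Christoffel symbols `Γ^β_{βγ}`: the logarithmic derivatives of the volume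
element. -/
def logVolumeDeriv (γ : Fin k) : A S.U := ∑ α, ∑ β, S.gram⁻¹ α β * S.christoffel γ α β

lemma pd_volumeElement (γ : Fin k) :
    pd S.U γ S.volumeElement = S.volumeElement * S.logVolumeDeriv γ := by
  rw [logVolumeDeriv]
  have h1 := congrArg (pdDer S.U γ) S.volumeElement_sq
  have h2 : ∑ i, ∑ j, S.gram.adjugate i j * pdDer S.U γ (S.gram j i) =
      S.gram.det * (2 * ∑ α, ∑ β, S.gram⁻¹ α β * S.christoffel γ α β) := by
    have h3 : ∑ α, ∑ β, S.gram⁻¹ α β * S.christoffel γ β α =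
        ∑ α, ∑ β, S.gram⁻¹ α β * S.christoffel γ α β := by
      rw [Finset.sum_comm]
      simp only [S.inv_gram_symm]
    rw [two_mul]
    nth_rewrite 1 [← h3]
    simp only [pdDer_apply, S.pd_gram, S.adjugate_gram, mul_add, Finset.sum_add_distrib,
      Finset.mul_sum, mul_assoc]
  rw [derivation_det, h2, Derivation.leibniz_pow, ← volumeElement_sq] at h1
  refine S.isUnit_volumeElement.mul_left_cancel ?_
  refine A.ext_eval fun x => ?_
  have h4 := congrArg (A.eval x) h1
  simp only [map_mul, map_pow, smul_eq_mul, nsmul_eq_mul, map_natCast, map_ofNat, pdDer_apply] at h4 ⊢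
  push_cast at h4
  linear_combination h4 / 2

/-- The derivatives of the volume element and of the inverse metric combine to the contracted
Christoffel symbols. -/
lemma drift_eq (β : Fin k) : S.drift β = ∑ α, (pd S.U α (S.gram⁻¹ α β) +
    S.logVolumeDeriv α * S.gram⁻¹ α β) := by
  refine (congrFun (S.eq_drift (b := fun β => ∑ α, (pd S.U α (S.gram⁻¹ α β) +
    S.logVolumeDeriv α * S.gram⁻¹ α β)) fun ε => ?_) β).symm
  have h1 : ∀ α, ∑ β, S.gram⁻¹ α β * S.gram β ε = if α = ε then 1 else 0 := fun α => by
    rw [← Matrix.mul_apply, Matrix.nonsing_inv_mul _ S.isUnit_det_gram, Matrix.one_apply]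
  have h2 : ∀ α, ∑ β, pd S.U α (S.gram⁻¹ α β) * S.gram β ε =
      -∑ β, S.gram⁻¹ α β * (S.christoffel α β ε + S.christoffel α ε β) := fun α => by
    have h3 := congrArg (pdDer S.U α) (h1 α)
    have h4 : pdDer S.U α (if α = ε then (1 : A S.U) else 0) = 0 := by
      split_ifs
      · exact Derivation.map_one_eq_zero _
      · exact map_zero _
    rw [h4, map_sum] at h3
    simp only [Derivation.leibniz, pdDer_apply, smul_eq_mul, Finset.sum_add_distrib, S.pd_gram] at h3
    rw [eq_neg_iff_add_eq_zero, add_comm, ← h3]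
    congr 1
    exact Finset.sum_congr rfl fun _ _ => mul_comm _ _
  calc ∑ β, (∑ α, (pd S.U α (S.gram⁻¹ α β) +
        S.logVolumeDeriv α * S.gram⁻¹ α β)) * S.gram β ε
      = ∑ α, (∑ β, pd S.U α (S.gram⁻¹ α β) * S.gram β ε +
          S.logVolumeDeriv α * ∑ β, S.gram⁻¹ α β * S.gram β ε) := by
        simp only [Finset.sum_mul, Finset.mul_sum, ← Finset.sum_add_distrib]
        rw [Finset.sum_comm]
        exact Finset.sum_congr rfl fun α _ => Finset.sum_congr rfl fun β _ => by ring
    _ = _ := by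
        simp only [h1, h2, logVolumeDeriv, mul_ite, mul_one, mul_zero, Finset.sum_add_distrib,
          Finset.sum_ite_eq', Finset.mem_univ, if_true, Finset.sum_neg_distrib, mul_add, S.christoffel_comm ε]
        ring

lemma beltramiLaplace_eq (ψ : A S.U) (x : S.U) :
    S.beltramiLaplace ψ x = (secondOrder S.gram⁻¹ S.drift 0).app ψ x := by
  have h1 : S.beltramiLaplace ψ x = (A.eval x S.volumeElement)⁻¹ *
      A.eval x (∑ α, ∑ β, pd S.U α (S.volumeElement * S.gram⁻¹ α β * pd S.U β ψ)) := by
    simp only [map_sum]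
    rw [beltramiLaplace]
    refine congrArg₂ (· * ·) rfl (Finset.sum_congr rfl fun α _ => Finset.sum_congr rfl fun β _ => ?_)
    rw [A.eval_apply, pd_apply]
    refine (partialDeriv_congr (ext_eventuallyEq S.U _ _ (fun y => ?_) x)).symm
    change A.eval y S.volumeElement * A.eval y (S.gram⁻¹ α β) * _ = _
    rw [eval_inv_gram, Complex.ofReal_mul]
    rfl
  have h2 : ∑ α, ∑ β, pd S.U α (S.volumeElement * S.gram⁻¹ α β * pd S.U β ψ) =
      S.volumeElement * (secondOrder S.gram⁻¹ S.drift 0).app ψ := by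
    rw [secondOrder_app, zero_mul, add_zero]
    simp only [drift_eq, pd_mul, pd_volumeElement]
    simp only [Finset.sum_mul, Finset.mul_sum, mul_add]
    rw [Finset.sum_comm (f := fun β α => _ * (_ * _)), ← Finset.sum_add_distrib]
    refine Finset.sum_congr rfl fun α _ => ?_
    rw [← Finset.sum_add_distrib]
    exact Finset.sum_congr rfl fun β _ => by ring
  have h3 := (S.isUnit_volumeElement.map (A.eval x)).ne_zero
  rw [h1, h2, map_mul, inv_mul_cancel_left₀ h3]
  rfl

end Patch

/-! ### Existence of tubular neighbourhoods -/

section Existence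

variable {k n d : ℕ}

lemma hasFDerivAt_normalMap_zeroSection {X : (Fin k → ℝ) → EuclideanSpace ℝ (Fin n)}
    {N : Fin d → (Fin k → ℝ) → EuclideanSpace ℝ (Fin n)} {x : Fin k → ℝ}
    (hX : DifferentiableAt ℝ X x) (hN : ∀ a, DifferentiableAt ℝ (N a) x) :
    HasFDerivAt (normalMap X N) ((fderiv ℝ X x).comp (Tube.projection k d) +
      ∑ a, (ContinuousLinearMap.proj (R := ℝ) (φ := fun _ : Fin k ⊕ Fin d => ℝ) (Sum.inr a)).smulRight
        (N a x)) (Sum.elim x 0) := by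
  have hp : Tube.projection k d (Sum.elim x 0) = x := by ext i; rfl
  have hcomp : ∀ {F : (Fin k → ℝ) → EuclideanSpace ℝ (Fin n)}, DifferentiableAt ℝ F x →
      HasFDerivAt (fun u => F (Tube.projection k d u)) ((fderiv ℝ F x).comp (Tube.projection k d))
        (Sum.elim x 0) := by
    intro F hF
    have h1 : HasFDerivAt F (fderiv ℝ F x) (Tube.projection k d (Sum.elim x 0)) := by
      rw [hp]; exact hF.hasFDerivAt
    exact h1.comp _ (Tube.projection k d).hasFDerivAt
  refine (hcomp hX).add (HasFDerivAt.fun_sum fun a _ => ?_)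
  have h2 := (ContinuousLinearMap.proj (R := ℝ) (φ := fun _ : Fin k ⊕ Fin d => ℝ)
    (Sum.inr a)).hasFDerivAt (x := (Sum.elim x 0 : Fin k ⊕ Fin d → ℝ)) |>.smul (hcomp (hN a))
  refine h2.congr_fderiv ?_
  ext1 v
  simp [hp]

lemma analyticAt_normalMap {X : (Fin k → ℝ) → EuclideanSpace ℝ (Fin n)}
    {N : Fin d → (Fin k → ℝ) → EuclideanSpace ℝ (Fin n)} {u : Fin k ⊕ Fin d → ℝ}
    (hX : AnalyticAt ℝ X (u ∘ Sum.inl)) (hN : ∀ a, AnalyticAt ℝ (N a) (u ∘ Sum.inl)) :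
    AnalyticAt ℝ (normalMap X N) u := by
  have hl : AnalyticAt ℝ (fun v : Fin k ⊕ Fin d → ℝ => v ∘ Sum.inl) u :=
    (Tube.projection k d).analyticAt u
  refine (hX.comp_of_eq hl rfl).add (Finset.analyticAt_fun_sum _ fun a _ => ?_)
  exact (analyticAt_coord _ _).smul ((hN a).comp_of_eq hl rfl)

/-- An analytic orthonormal frame of the normal bundle has a tubular neighbourhood: where the
derivative of `Φ` is invertible, which is an open condition and holds along the zero section. -/
lemma nonempty_tube (S : Patch k n) (hn : k + d = n)
    (N : Fin d → (Fin k → ℝ) → EuclideanSpace ℝ (Fin n))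
    (hN : ∀ a, ∀ x ∈ S.U, AnalyticAt ℝ (N a) x)
    (ho : ∀ x ∈ S.U, Orthonormal ℝ (fun a => N a x))
    (hnormal : ∀ x ∈ S.U, ∀ a α, ⟪partialDeriv α S.X x, N a x⟫_ℝ = 0) : Nonempty (Tube S d) := by
  let V : Set (Fin k ⊕ Fin d → ℝ) := Tube.projection k d ⁻¹' S.U
  have hV : IsOpen V := S.U.isOpen.preimage (Tube.projection k d).continuous
  let inv : Set ((Fin k ⊕ Fin d → ℝ) →L[ℝ] EuclideanSpace ℝ (Fin n)) :=
    Set.range ((↑) : ((Fin k ⊕ Fin d → ℝ) ≃L[ℝ] EuclideanSpace ℝ (Fin n)) → _)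
  have hcont : ContinuousOn (fderiv ℝ (normalMap S.X N)) V := fun u hu =>
    (analyticAt_normalMap (S.analytic _ hu) fun a => hN a _ hu).fderiv.continuousAt.continuousWithinAt
  have hinner : ∀ x ∈ S.U, ∀ v a, ⟪fderiv ℝ S.X x v, N a x⟫_ℝ = 0 := by
    intro x hx v a
    rw [pi_eq_sum_univ' v, map_sum, sum_inner]
    refine Finset.sum_eq_zero fun α _ => ?_
    rw [map_smul, inner_smul_left]
    change _ * ⟪partialDeriv α S.X x, N a x⟫_ℝ = 0
    rw [hnormal x hx, mul_zero]
  refine ⟨⟨N, hN, ho, hnormal, ⟨V ∩ fderiv ℝ (normalMap S.X N) ⁻¹' inv,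
    hcont.isOpen_inter_preimage hV ContinuousLinearEquiv.isOpen⟩, fun u hu => hu.1,
    fun x hx => ⟨hx, ?_⟩, ?_⟩⟩
  · have hd := (hasFDerivAt_normalMap_zeroSection (S.analytic x hx).differentiableAt
      fun a => (hN a x hx).differentiableAt).fderiv
    have hinj : Function.Injective (fderiv ℝ (normalMap S.X N) (Sum.elim x 0)) := by
      refine (injective_iff_map_eq_zero _).2 fun v hv => ?_
      rw [hd] at hv
      simp only [add_apply, ContinuousLinearMap.comp_apply,
        sum_apply, ContinuousLinearMap.smulRight_apply,
        ContinuousLinearMap.proj_apply] at hv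
      have h1 : ∀ a, v (Sum.inr a) = 0 := by
        intro a
        have h2 := congrArg (fun z => ⟪z, N a x⟫_ℝ) hv
        simp only [inner_add_left, sum_inner, inner_smul_left, hinner x hx,
          orthonormal_iff_ite.1 (ho x hx), inner_zero_left] at h2
        simpa using h2
      have h3 : Tube.projection k d v = 0 := by
        refine S.immersion x hx ?_
        simpa [h1] using hv
      ext i
      rcases i with α | a
      · exact congrFun h3 α
      · exact h1 a
    have hsurj := (LinearMap.injective_iff_surjective_of_finrank_eq_finrank
      (f := (fderiv ℝ (normalMap S.X N) (Sum.elim x 0)).toLinearMap) (by simp [hn])).1 hinj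
    exact ⟨ContinuousLinearEquiv.ofBijective _ (LinearMap.ker_eq_bot.2 hinj)
      (LinearMap.range_eq_top.2 hsurj), ContinuousLinearEquiv.coe_ofBijective _ _ _⟩
  · rintro u ⟨-, e, he⟩
    rw [← he]
    exact e.bijective

/-! ### The vector product -/

lemma analyticAt_cross {ι : Type} [Fintype ι] {v w : (ι → ℝ) → EuclideanSpace ℝ (Fin 3)}
    {x : ι → ℝ} (hv : AnalyticAt ℝ v x) (hw : AnalyticAt ℝ w x) :
    AnalyticAt ℝ (fun y => cross (v y) (w y)) x := by
  have h : AnalyticAt ℝ (fun y => crossProduct (WithLp.ofLp (v y)) (WithLp.ofLp (w y))) x := by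
    refine analyticAt_pi_iff.2 fun i => ?_
    simp only [cross_apply]
    fin_cases i
    · exact ((analyticAt_apply hv 1).mul (analyticAt_apply hw 2)).sub
        ((analyticAt_apply hv 2).mul (analyticAt_apply hw 1))
    · exact ((analyticAt_apply hv 2).mul (analyticAt_apply hw 0)).sub
        ((analyticAt_apply hv 0).mul (analyticAt_apply hw 2))
    · exact ((analyticAt_apply hv 0).mul (analyticAt_apply hw 1)).sub
        ((analyticAt_apply hv 1).mul (analyticAt_apply hw 0))
  exact ((PiLp.continuousLinearEquiv 2 ℝ fun _ : Fin 3 => ℝ).symm.analyticAt _).comp h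

lemma analyticAt_normalize {ι : Type} [Fintype ι] {v : (ι → ℝ) → EuclideanSpace ℝ (Fin 3)}
    {x : ι → ℝ} (hv : AnalyticAt ℝ v x) (h0 : v x ≠ 0) :
    AnalyticAt ℝ (fun y => ‖v y‖⁻¹ • v y) x := by
  have h1 : AnalyticAt ℝ (fun z : EuclideanSpace ℝ (Fin 3) => ‖z‖) (v x) :=
    ContDiffAt.analyticAt (contDiffAt_norm ℝ h0)
  exact ((h1.comp hv).inv (norm_ne_zero_iff.2 h0)).smul hv

lemma inner_fin_three (v w : EuclideanSpace ℝ (Fin 3)) :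
    ⟪v, w⟫_ℝ = v 0 * w 0 + v 1 * w 1 + v 2 * w 2 := by
  rw [PiLp.inner_apply, Fin.sum_univ_three]
  simp only [RCLike.inner_apply, conj_trivial]
  ring

lemma cross_apply_zero (v w : EuclideanSpace ℝ (Fin 3)) :
    cross v w 0 = v 1 * w 2 - v 2 * w 1 := by simp [cross, cross_apply]

lemma cross_apply_one (v w : EuclideanSpace ℝ (Fin 3)) :
    cross v w 1 = v 2 * w 0 - v 0 * w 2 := by simp [cross, cross_apply]

lemma cross_apply_two (v w : EuclideanSpace ℝ (Fin 3)) :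
    cross v w 2 = v 0 * w 1 - v 1 * w 0 := by simp [cross, cross_apply]

lemma inner_cross_left (v w : EuclideanSpace ℝ (Fin 3)) : ⟪v, cross v w⟫_ℝ = 0 := by
  rw [inner_fin_three, cross_apply_zero, cross_apply_one, cross_apply_two]
  ring

lemma inner_cross_right (v w : EuclideanSpace ℝ (Fin 3)) : ⟪w, cross v w⟫_ℝ = 0 := by
  rw [inner_fin_three, cross_apply_zero, cross_apply_one, cross_apply_two]
  ring

/-- Lagrange's identity. -/
lemma inner_cross_self (v w : EuclideanSpace ℝ (Fin 3)) :
    ⟪cross v w, cross v w⟫_ℝ = ⟪v, v⟫_ℝ * ⟪w, w⟫_ℝ - ⟪v, w⟫_ℝ ^ 2 := by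
  simp only [inner_fin_three, cross_apply_zero, cross_apply_one, cross_apply_two]
  ring

/-- The triple vector product. -/
lemma cross_cross (u v w : EuclideanSpace ℝ (Fin 3)) :
    cross (cross u v) w = ⟪u, w⟫_ℝ • v - ⟪v, w⟫_ℝ • u := by
  ext i
  fin_cases i <;>
    simp [inner_fin_three, cross_apply_zero, cross_apply_one, cross_apply_two] <;> ring

lemma exists_cross_ne_zero {v : EuclideanSpace ℝ (Fin 3)} (hv : v ≠ 0) : ∃ w, cross v w ≠ 0 := by
  by_contra! h
  refine hv ?_
  have h0 := h (EuclideanSpace.single 0 1)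
  have h1 := h (EuclideanSpace.single 1 1)
  ext i
  fin_cases i
  · simpa [cross_apply_two] using congrArg (fun z : EuclideanSpace ℝ (Fin 3) => z 2) h1
  · simpa [cross_apply_two] using congrArg (fun z : EuclideanSpace ℝ (Fin 3) => z 2) h0
  · simpa [cross_apply_one] using congrArg (fun z : EuclideanSpace ℝ (Fin 3) => z 1) h0

/-- A unit vector that is normal to two vectors is a multiple of the unit vector in the direction of
their vector product. -/
lemma eq_smul_of_inner_eq_zero {v w N : EuclideanSpace ℝ (Fin 3)} (hN : ‖N‖ = 1)
    (hv : ⟪v, N⟫_ℝ = 0) (hw : ⟪w, N⟫_ℝ = 0) (h0 : cross v w ≠ 0) :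
    ∃ ε : ℝ, ε ^ 2 = 1 ∧ N = ε • (‖cross v w‖⁻¹ • cross v w) := by
  set ν := ‖cross v w‖⁻¹ • cross v w with hν
  have hν1 : ⟪ν, ν⟫_ℝ = 1 := by
    rw [real_inner_self_eq_norm_sq, hν, norm_smul, norm_inv, norm_norm,
      inv_mul_cancel₀ (norm_ne_zero_iff.2 h0), one_pow]
  have hN1 : ⟪N, N⟫_ℝ = 1 := by rw [real_inner_self_eq_norm_sq, hN, one_pow]
  have hc : cross ν N = 0 := by
    have h1 : cross ν N = ‖cross v w‖⁻¹ • cross (cross v w) N := by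
      ext i
      fin_cases i <;> simp [hν, cross_apply_zero, cross_apply_one, cross_apply_two] <;> ring
    rw [h1, cross_cross, hv, hw]
    simp
  have h2 := inner_cross_self ν N
  rw [hc, inner_zero_left, hν1, hN1] at h2
  refine ⟨⟪ν, N⟫_ℝ, by linarith, ?_⟩
  clear_value ν
  rw [← sub_eq_zero, ← inner_self_eq_zero (𝕜 := ℝ), inner_sub_sub_self, inner_smul_left,
    inner_smul_right, inner_smul_left, inner_smul_right, hN1, hν1, real_inner_comm ν N]
  simp only [conj_trivial]
  linarith

lemma Patch.inner_cross_eq_det (S : Patch 2 3) (x : Fin 2 → ℝ) :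
    ⟪cross (partialDeriv 0 S.X x) (partialDeriv 1 S.X x),
      cross (partialDeriv 0 S.X x) (partialDeriv 1 S.X x)⟫_ℝ = (S.metric x).det := by
  rw [inner_cross_self, Matrix.det_fin_two, Patch.metric]
  simp only [Matrix.gram_apply]
  rw [real_inner_comm (partialDeriv 0 S.X x) (partialDeriv 1 S.X x), pow_two]

lemma Patch.cross_ne_zero (S : Patch 2 3) (x : S.U) :
    cross (partialDeriv 0 S.X x) (partialDeriv 1 S.X x) ≠ 0 := by
  intro h
  have h1 := S.inner_cross_eq_det x
  rw [h, inner_zero_left] at h1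
  exact (S.posDef_metric x).det_pos.ne h1

lemma norm_normalize {v : EuclideanSpace ℝ (Fin 3)} (hv : v ≠ 0) : ‖‖v‖⁻¹ • v‖ = 1 := by
  rw [norm_smul, norm_inv, norm_norm, inv_mul_cancel₀ (norm_ne_zero_iff.2 hv)]

lemma Patch.nonempty_tube (S : Patch 2 3) : Nonempty (Tube S 1) := by
  refine SubmanifoldSchrodinger.nonempty_tube S rfl (fun _ => S.unitNormal) (fun _ x hx => ?_)
    (fun x hx => ?_) fun x hx _ α => ?_
  · exact analyticAt_normalize (analyticAt_cross (analyticAt_partialDeriv _ (S.analytic x hx))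
      (analyticAt_partialDeriv _ (S.analytic x hx))) (S.cross_ne_zero ⟨x, hx⟩)
  · refine ⟨fun _ => norm_normalize (S.cross_ne_zero ⟨x, hx⟩), fun a b hab => ?_⟩
    exact absurd (Subsingleton.elim a b) hab
  · rw [Patch.unitNormal, inner_smul_right]
    fin_cases α
    · exact mul_eq_zero_of_right _ (inner_cross_left _ _)
    · exact mul_eq_zero_of_right _ (inner_cross_right _ _)

lemma partialDeriv_comp_apply {F : ℝ → EuclideanSpace ℝ (Fin 3)} {x : Fin 1 → ℝ}
    (hF : DifferentiableAt ℝ F (x 0)) :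
    partialDeriv 0 (fun u : Fin 1 → ℝ => F (u 0)) x = deriv F (x 0) := by
  have h2 := HasFDerivAt.comp (f := fun u : Fin 1 → ℝ => u 0) x hF.hasDerivAt.hasFDerivAt
    (ContinuousLinearMap.proj (R := ℝ) (φ := fun _ : Fin 1 => ℝ) 0).hasFDerivAt
  have h3 : fderiv ℝ (fun u : Fin 1 → ℝ => F (u 0)) x = _ := h2.fderiv
  rw [partialDeriv, h3]
  simp

lemma exists_nonempty_tube_curvePatch (I : TopologicalSpace.Opens ℝ)
    (c : ℝ → EuclideanSpace ℝ (Fin 3)) (hc : ∀ s ∈ I, AnalyticAt ℝ c s)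
    (hs : ∀ s ∈ I, ‖deriv c s‖ = 1) (x : Fin 1 → ℝ) (hx : x ∈ (curvePatch I c hc hs).U) :
    ∃ (V : TopologicalSpace.Opens (Fin 1 → ℝ)) (hV : V ≤ (curvePatch I c hc hs).U), x ∈ V ∧
      Nonempty (Tube ((curvePatch I c hc hs).restrict V hV) 2) := by
  set S := curvePatch I c hc hs with hS
  have hτ : ∀ y ∈ S.U, AnalyticAt ℝ (partialDeriv 0 S.X) y := fun y hy =>
    analyticAt_partialDeriv 0 (S.analytic y hy)
  have hτ1 : ∀ y ∈ S.U, ‖partialDeriv 0 S.X y‖ = 1 := fun y hy => by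
    have h : partialDeriv 0 S.X y = deriv c (y 0) :=
      partialDeriv_comp_apply (hc _ hy).differentiableAt
    rw [h, hs _ hy]
  -- a fixed vector `w` that is not tangent at `x`, hence not near `x` either
  obtain ⟨w, hw⟩ := exists_cross_ne_zero (v := partialDeriv 0 S.X x) fun h => by
    have := hτ1 x hx
    simp [h] at this
  have hcross : ∀ y ∈ S.U, AnalyticAt ℝ (fun y => cross (partialDeriv 0 S.X y) w) y := fun y hy =>
    analyticAt_cross (hτ y hy) analyticAt_const
  have hopen : IsOpen ((S.U : Set (Fin 1 → ℝ)) ∩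
      (fun y => cross (partialDeriv 0 S.X y) w) ⁻¹' {0}ᶜ) :=
    ContinuousOn.isOpen_inter_preimage
      (fun y hy => (hcross y hy).continuousAt.continuousWithinAt) S.U.isOpen isOpen_compl_singleton
  refine ⟨⟨_, hopen⟩, fun y hy => hy.1, ⟨hx, hw⟩, ?_⟩
  let N₁ : (Fin 1 → ℝ) → EuclideanSpace ℝ (Fin 3) := fun y =>
    ‖cross (partialDeriv 0 S.X y) w‖⁻¹ • cross (partialDeriv 0 S.X y) w
  let N₂ : (Fin 1 → ℝ) → EuclideanSpace ℝ (Fin 3) := fun y => cross (partialDeriv 0 S.X y) (N₁ y)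
  have h11 : ∀ y, cross (partialDeriv 0 S.X y) w ≠ 0 → ‖N₁ y‖ = 1 := fun y hy => norm_normalize hy
  have hτN₁ : ∀ y, ⟪partialDeriv 0 S.X y, N₁ y⟫_ℝ = 0 := fun y => by
    rw [inner_smul_right, inner_cross_left, mul_zero]
  refine nonempty_tube _ rfl ![N₁, N₂] (fun a y hy => ?_) (fun y hy => ?_) fun y hy a α => ?_
  · have h1 : AnalyticAt ℝ N₁ y := analyticAt_normalize (hcross y hy.1) hy.2
    fin_cases a
    · exact h1
    · exact analyticAt_cross (hτ y hy.1) h1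
  · have h22 : ‖N₂ y‖ = 1 := by
      have h := inner_cross_self (partialDeriv 0 S.X y) (N₁ y)
      rw [real_inner_self_eq_norm_sq, real_inner_self_eq_norm_sq, real_inner_self_eq_norm_sq,
        hτ1 y hy.1, h11 y hy.2, hτN₁] at h
      refine (pow_eq_one_iff_of_nonneg (norm_nonneg _) two_ne_zero).1 ?_
      rw [h]
      norm_num
    have h12 : ⟪N₁ y, N₂ y⟫_ℝ = 0 := inner_cross_right _ _
    refine orthonormal_iff_ite.2 fun a b => ?_
    fin_cases a <;> fin_cases b
    · simp [h11 y hy.2]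
    · simp [h12]
    · simp [real_inner_comm, h12]
    · simp [h22]
  · obtain rfl := Subsingleton.elim α 0
    fin_cases a
    · exact hτN₁ y
    · exact inner_cross_left _ _

end Existence

/-! ### The potential in terms of curvatures -/

namespace Tube

variable {k n d : ℕ} {S : Patch k n} (t : Tube S d)

lemma submanifoldOperator_app (ψ : A S.U) (x : S.U) : t.submanifoldOperator.app ψ x =
    S.beltramiLaplace ψ x - A.eval x (∑ a, t.potential a) * ψ x := by
  have h : t.submanifoldOperator.app ψ =
      (secondOrder S.gram⁻¹ S.drift 0).app ψ - (∑ a, t.potential a) * ψ := by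
    rw [submanifoldOperator, secondOrder_app, secondOrder_app]
    ring
  rw [h, S.beltramiLaplace_eq]
  rfl

lemma principal_submanifoldOperator : ∃ f : A S.U, ∀ (ψ : A S.U) (x : S.U),
    t.submanifoldOperator.app ψ x = S.beltramiLaplace ψ x + f x * ψ x := by
  refine ⟨-∑ a, t.potential a, fun ψ x => ?_⟩
  rw [submanifoldOperator_app, sub_eq_add_neg, ← neg_mul]
  rfl

lemma eval_secondForm (x : S.U) (a : Fin d) (α β : Fin k) : A.eval x (t.secondForm a α β) =
    (⟪partialDeriv α (partialDeriv β S.X) x, t.N a x⟫_ℝ : ℂ) := by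
  rw [secondForm, Matrix.of_apply, map_sum, ofReal_inner]
  refine Finset.sum_congr rfl fun m _ => ?_
  rw [map_mul, eval_normalFrame, Patch.cartesian, pd_component, pd_component]
  rfl

lemma pd_pd_offsetGram (a : Fin d) (α β : Fin k) :
    pd t.T (Sum.inr a) (pd t.T (Sum.inr a) (t.offsetGram α β)) = 0 := by
  rw [pd_inr_offsetGram, map_neg, pd_inr_extend, neg_zero]

/-- The squared length of a vector field along `S` in terms of the orthogonal frame of tangential
and normal vectors. -/
lemma sum_sq_eq {S : Patch k n} (t : Tube S d) (hn : k + d = n) (hg : S.gram = 1)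
    (v : Fin n → A S.U) : ∑ m, v m ^ 2 =
      ∑ α, (∑ m, v m * S.jacobian α m) ^ 2 + ∑ a, (∑ m, v m * t.normalFrame a m) ^ 2 := by
  set J : Matrix (Fin k ⊕ Fin d) (Fin n) (A S.U) := .of fun i m => t.toSHom (t.jacobian i m) with hJ
  have h1 : J * Jᵀ = 1 := by
    rw [← Matrix.fromBlocks_one, ← hg, ← toSHom_gramT]
    refine Matrix.ext fun i j => ?_
    change _ = t.toSHom (t.gramT i j)
    simp only [gramT, Matrix.mul_apply, Matrix.transpose_apply, map_sum, map_mul, hJ,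
      Matrix.of_apply]
  have h2 : Jᵀ * J = 1 := (Matrix.mul_eq_one_comm_of_card_eq _ _ _ (by simp [hn])).1 h1
  have h3 : v ⬝ᵥ v = (J *ᵥ v) ⬝ᵥ (J *ᵥ v) := by
    rw [Matrix.dotProduct_mulVec, ← Matrix.mulVec_transpose, Matrix.mulVec_mulVec, h2,
      Matrix.one_mulVec]
  simp only [dotProduct, Matrix.mulVec, Fintype.sum_sum_type, hJ, Matrix.of_apply,
    toSHom_jacobian_inl, toSHom_jacobian_inr, ← pow_two] at h3
  simp only [h3, mul_comm (v _)]

end Tube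

/-! ### Curves -/

section Curve

variable {I : TopologicalSpace.Opens ℝ} {c : ℝ → EuclideanSpace ℝ (Fin 3)}
  {hc : ∀ s ∈ I, AnalyticAt ℝ c s} {hs : ∀ s ∈ I, ‖deriv c s‖ = 1}

lemma partialDeriv_curvePatch (x : (curvePatch I c hc hs).U) :
    partialDeriv 0 (curvePatch I c hc hs).X x = deriv c (x.1 0) :=
  partialDeriv_comp_apply (hc _ x.2).differentiableAt

lemma partialDeriv_partialDeriv_curvePatch (x : (curvePatch I c hc hs).U) :
    partialDeriv 0 (partialDeriv 0 (curvePatch I c hc hs).X) x = deriv (deriv c) (x.1 0) := by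
  have h : partialDeriv 0 (curvePatch I c hc hs).X =ᶠ[nhds (x : Fin 1 → ℝ)]
      fun u => deriv c (u 0) := by
    filter_upwards [(curvePatch I c hc hs).U.isOpen.mem_nhds x.2] with y hy
    exact partialDeriv_curvePatch ⟨y, hy⟩
  rw [partialDeriv_congr h]
  exact partialDeriv_comp_apply (hc _ x.2).deriv.differentiableAt

lemma gram_curvePatch : (curvePatch I c hc hs).gram = 1 := by
  refine Matrix.ext fun α β => A.ext_eval fun x => ?_
  obtain rfl := Subsingleton.elim α 0
  obtain rfl := Subsingleton.elim β 0
  rw [Patch.eval_gram, Patch.metric, Matrix.gram_apply, partialDeriv_curvePatch,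
    real_inner_self_eq_norm_sq, hs _ x.2]
  simp

lemma christoffel_curvePatch : (curvePatch I c hc hs).christoffel 0 0 0 = 0 := by
  have h := (curvePatch I c hc hs).pd_gram 0 0 0
  have h1 : pd (curvePatch I c hc hs).U 0 (1 : A (curvePatch I c hc hs).U) = 0 :=
    (pdDer _ 0).map_one_eq_zero
  rw [gram_curvePatch, Matrix.one_apply_eq, h1] at h
  refine A.ext_eval fun x => ?_
  have h2 := congrArg (A.eval x) h
  rw [map_zero, map_add] at h2
  rw [map_zero]
  linear_combination -h2 / 2

lemma beltramiLaplace_curvePatch (ψ : A (curvePatch I c hc hs).U) (x : (curvePatch I c hc hs).U) :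
    (curvePatch I c hc hs).beltramiLaplace ψ x = pd _ 0 (pd _ 0 ψ) x := by
  rw [Patch.beltramiLaplace_eq, secondOrder_app, gram_curvePatch, inv_one]
  simp only [Patch.drift, Finset.univ_unique, Fin.default_eq_zero, Finset.sum_singleton,
    Matrix.one_apply_eq, christoffel_curvePatch, one_mul, mul_zero, neg_zero, zero_mul, add_zero]

lemma potential_curvePatch (t : Tube (curvePatch I c hc hs) 2) (a : Fin 2) :
    4 * t.potential a = -t.secondForm a 0 0 ^ 2 := by
  have h := t.det_mul_potential rfl a
  have h1 : t.offsetGram.det = t.offsetGram 0 0 := Matrix.det_fin_one _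
  rw [h1, t.pd_pd_offsetGram, Tube.meanTrace, gram_curvePatch, Matrix.det_one, inv_one] at h
  simpa using h

lemma sum_potential_curvePatch (t : Tube (curvePatch I c hc hs) 2)
    (x : (curvePatch I c hc hs).U) :
    A.eval x (∑ a, t.potential a) = -(1 / 4) * (curvature c (x.1 0) : ℂ) ^ 2 := by
  have h1 := t.sum_sq_eq rfl gram_curvePatch
    fun m => pd _ 0 (pd _ 0 ((curvePatch I c hc hs).cartesian m))
  have h2 := congrArg (A.eval x) h1
  have h3 := christoffel_curvePatch (hc := hc) (hs := hs)
  rw [Patch.christoffel] at h3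
  simp only [Finset.univ_unique, Fin.default_eq_zero, Finset.sum_singleton, h3] at h2
  have h4 : A.eval x (∑ m, pd _ 0 (pd _ 0 ((curvePatch I c hc hs).cartesian m)) ^ 2) =
      (curvature c (x.1 0) : ℂ) ^ 2 := by
    rw [curvature, ← Complex.ofReal_pow, ← real_inner_self_eq_norm_sq, Tube.ofReal_inner, map_sum]
    refine Finset.sum_congr rfl fun m _ => ?_
    rw [map_pow, Patch.cartesian, pd_component, pd_component,
      ← partialDeriv_partialDeriv_curvePatch (hc := hc) (hs := hs) x, pow_two]
    rfl
  have h5 := fun a => congrArg (A.eval x) (potential_curvePatch t a)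
  simp only [map_mul, map_neg, map_pow, map_ofNat] at h5
  rw [h4] at h2
  change _ = A.eval x (0 ^ 2 + ∑ a, t.secondForm a 0 0 ^ 2) at h2
  rw [zero_pow two_ne_zero, zero_add, map_sum, Fin.sum_univ_two, map_pow, map_pow] at h2
  rw [map_sum, Fin.sum_univ_two, h2]
  linear_combination h5 0 / 4 + h5 1 / 4

lemma norm_complexCurvature (c : ℝ → EuclideanSpace ℝ (Fin 3)) (s₀ s : ℝ) :
    ‖complexCurvature c s₀ s‖ = curvature c s := by
  rw [complexCurvature, norm_mul, mul_comm Complex.I, Complex.norm_exp_ofReal_mul_I, mul_one,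
    Complex.norm_real, curvature, norm_norm]

end Curve

/-! ### Surfaces -/

namespace Patch

variable (S : Patch 2 3)

/-- The second fundamental form with respect to the unit normal. -/
def secondForm (x : Fin 2 → ℝ) : Matrix (Fin 2) (Fin 2) ℝ :=
  .of fun α β => ⟪partialDeriv α (partialDeriv β S.X) x, S.unitNormal x⟫_ℝ

lemma secondForm_symm (x : S.U) : S.secondForm x 1 0 = S.secondForm x 0 1 := by
  simp only [secondForm, Matrix.of_apply]
  rw [partialDeriv_comm 0 1 (S.analytic x x.2)]

lemma metric_symm (x : Fin 2 → ℝ) : S.metric x 1 0 = S.metric x 0 1 := by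
  simp only [metric, Matrix.gram_apply]
  exact real_inner_comm _ _

lemma gaussCurvature_eq (x : S.U) :
    S.gaussCurvature x = (S.secondForm x).det / (S.metric x).det := by
  rw [gaussCurvature, weingarten, Matrix.det_mul, Matrix.det_nonsing_inv, Ring.inverse_eq_inv',
    div_eq_inv_mul]
  rfl

lemma two_mul_meanCurvature (x : S.U) :
    2 * S.meanCurvature x = ∑ α, ∑ β, (S.metric x)⁻¹ α β * S.secondForm x β α := by
  rw [meanCurvature, mul_div_cancel₀ _ two_ne_zero]
  rfl

lemma gaussCurvature_le (x : S.U) : S.gaussCurvature x ≤ S.meanCurvature x ^ 2 := by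
  have hD := (S.posDef_metric x).det_pos
  have hE : 0 < S.metric x 0 0 := (S.posDef_metric x).diag_pos
  have h1 : S.metric x 0 0 * S.metric x 1 1 - S.metric x 0 1 ^ 2 = (S.metric x).det := by
    rw [Matrix.det_fin_two, metric_symm]; ring
  have h2 : 2 * S.meanCurvature x * (S.metric x).det =
      S.metric x 1 1 * S.secondForm x 0 0 - 2 * S.metric x 0 1 * S.secondForm x 0 1 +
        S.metric x 0 0 * S.secondForm x 1 1 := by
    rw [two_mul_meanCurvature, Matrix.inv_def, Matrix.adjugate_fin_two, Ring.inverse_eq_inv']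
    simp only [Fin.sum_univ_two, Matrix.smul_apply, Matrix.of_apply, Matrix.cons_val', Matrix.cons_val_zero,
      Matrix.cons_val_one, Matrix.cons_val_fin_one, smul_eq_mul, secondForm_symm, metric_symm]
    field_simp
    ring
  have h3 : S.gaussCurvature x * (S.metric x).det =
      S.secondForm x 0 0 * S.secondForm x 1 1 - S.secondForm x 0 1 ^ 2 := by
    rw [gaussCurvature_eq, div_mul_cancel₀ _ hD.ne', Matrix.det_fin_two, secondForm_symm]
    ring
  generalize S.metric x 0 0 = E, S.metric x 1 1 = G, S.metric x 0 1 = F, (S.metric x).det = D,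
    S.secondForm x 0 0 = L, S.secondForm x 0 1 = M, S.secondForm x 1 1 = N,
    S.meanCurvature x = H, S.gaussCurvature x = K at *
  -- the discriminant is a sum of squares since the metric is positive definite
  have h4 : 4 * (E * D) ^ 2 * (H ^ 2 - K) =
      (E * (E * N - G * L) - 2 * F * (E * M - F * L)) ^ 2 + 4 * D * (E * M - F * L) ^ 2 := by
    have h5 : 4 * (E * D) ^ 2 * (H ^ 2 - K) =
        E ^ 2 * ((2 * H * D) ^ 2 - 4 * D * (K * D)) := by ring
    rw [h5, h2, h3, ← h1]
    ring
  have h6 : 0 ≤ 4 * (E * D) ^ 2 * (H ^ 2 - K) := by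
    rw [h4]; positivity
  exact sub_nonneg.1 ((mul_nonneg_iff_of_pos_left (by positivity)).1 h6)

lemma exists_isPrincipalCurvatures (x : S.U) : ∃ k₁ k₂ : ℝ, S.IsPrincipalCurvatures x k₁ k₂ ∧
    (1 / 4) * (k₁ - k₂) ^ 2 = S.meanCurvature x ^ 2 - S.gaussCurvature x := by
  have h0 : 0 ≤ S.meanCurvature x ^ 2 - S.gaussCurvature x := sub_nonneg.2 (S.gaussCurvature_le x)
  have h1 := Real.sq_sqrt h0
  set r := Real.sqrt (S.meanCurvature x ^ 2 - S.gaussCurvature x)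
  refine ⟨S.meanCurvature x + r, S.meanCurvature x - r, ?_, by rw [← h1]; ring⟩
  have h2 : (S.weingarten x).trace = 2 * S.meanCurvature x := by rw [meanCurvature]; ring
  have h3 : (S.weingarten x).det = (S.meanCurvature x + r) * (S.meanCurvature x - r) := by
    change S.gaussCurvature x = _
    linear_combination h1
  rw [IsPrincipalCurvatures, Matrix.charpoly_fin_two, h2, h3]
  simp only [map_mul, map_add, map_sub, map_ofNat]
  ring

end Patch

lemma potential_surface {S : Patch 2 3} (t : Tube S 1) (x : S.U) : A.eval x (∑ a, t.potential a) =
    -((S.meanCurvature x : ℂ) ^ 2 - (S.gaussCurvature x : ℂ)) := by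
  obtain ⟨ε, hε, hN⟩ := eq_smul_of_inner_eq_zero ((t.orthonormal x x.2).1 0) (t.normal x x.2 0 0)
    (t.normal x x.2 0 1) (S.cross_ne_zero x)
  have hN' : t.N 0 x = ε • S.unitNormal x := hN
  have h1 : ∀ α β, A.eval x (t.secondForm 0 α β) = (ε : ℂ) * (S.secondForm x α β : ℂ) := by
    intro α β
    rw [t.eval_secondForm, hN', inner_smul_right, Complex.ofReal_mul]
    rfl
  have h2 : A.eval x (t.meanTrace 0) = ε * (2 * S.meanCurvature x : ℂ) := by
    have h := congrArg (fun r : ℝ => (r : ℂ)) (S.two_mul_meanCurvature x)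
    push_cast at h
    rw [h, Tube.meanTrace]
    simp only [Fin.sum_univ_two, map_add, map_mul, h1, S.eval_inv_gram, S.secondForm_symm]
    ring
  have h3 : t.toSHom (pd t.T (Sum.inr 0) (pd t.T (Sum.inr 0) t.offsetGram.det)) =
      2 * (t.secondForm 0 0 0 * t.secondForm 0 1 1 - t.secondForm 0 0 1 * t.secondForm 0 1 0) := by
    rw [Matrix.det_fin_two]
    simp only [map_sub, pd_mul, map_add, t.pd_inr_offsetGram, t.pd_inr_extend, map_neg, map_mul,
      t.toSHom_extend, mul_zero, neg_zero, map_zero]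
    ring
  have h4 := congrArg (A.eval x) (t.det_mul_potential rfl 0)
  have h5 : (S.gaussCurvature x : ℂ) * ((S.metric x).det : ℂ) =
      S.secondForm x 0 0 * S.secondForm x 1 1 - S.secondForm x 0 1 * S.secondForm x 1 0 := by
    rw [S.gaussCurvature_eq, ← Complex.ofReal_mul, div_mul_cancel₀ _ (S.posDef_metric x).det_pos.ne',
      Matrix.det_fin_two]
    push_cast
    ring
  have h6 : ((S.metric x).det : ℂ) ≠ 0 := by exact_mod_cast (S.posDef_metric x).det_pos.ne'
  have h7 : (ε : ℂ) ^ 2 = 1 := by exact_mod_cast hε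
  rw [h3] at h4
  simp only [map_mul, map_sub, map_pow, map_ofNat, h1, h2, S.eval_det_gram] at h4
  rw [Finset.univ_unique, Finset.sum_singleton, Fin.default_eq_zero]
  refine mul_left_cancel₀ (mul_ne_zero (by norm_num : (4 : ℂ) ≠ 0) h6) ?_
  linear_combination h4 - 4 * h5 + 4 * (S.secondForm x 0 0 * S.secondForm x 1 1 -
    S.secondForm x 0 1 * S.secondForm x 1 0 - (S.metric x).det * (S.meanCurvature x : ℂ) ^ 2) * h7

end SubmanifoldSchrodinger

end

open SubmanifoldSchrodinger in
/-- The submanifold Schrödinger operators of curves and surfaces in `𝔼³`. -/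
theorem theorem4p4 :
    -- curves, parametrised by arclength on an open interval
    (∀ (I : TopologicalSpace.Opens ℝ) (c : ℝ → EuclideanSpace ℝ (Fin 3))
        (hc : ∀ s ∈ I, AnalyticAt ℝ c s) (hs : ∀ s ∈ I, ‖deriv c s‖ = 1),
      Set.OrdConnected (I : Set ℝ) → ∀ s₀ ∈ I,
      -- tubular neighbourhoods exist locally
      (∀ x ∈ (curvePatch I c hc hs).U, ∃ (V : TopologicalSpace.Opens (Fin 1 → ℝ))
        (hV : V ≤ (curvePatch I c hc hs).U), x ∈ V ∧
          Nonempty (Tube ((curvePatch I c hc hs).restrict V hV) 2)) ∧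
      -- for each of them there is exactly one submanifold Schrödinger operator `L`
      ∀ t : Tube (curvePatch I c hc hs) 2, ∃ L : D (curvePatch I c hc hs).U,
        (∀ L', t.IsSubmanifoldSchrodingerOperator L' ↔ L' = L) ∧
        -- it is given by the complex curvature
        (∀ (ψ : A (curvePatch I c hc hs).U) (x : (curvePatch I c hc hs).U),
          (-L).app ψ x = -(pd _ 0 (pd _ 0 ψ)) x
            - (1 / 4) * (‖complexCurvature c s₀ (x.1 0)‖ : ℂ) ^ 2 * ψ x) ∧
        -- and agrees with the operator `-Δ_C - k² / 4` of Jensen-Koppe and da Costa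
        (∀ (ψ : A (curvePatch I c hc hs).U) (x : (curvePatch I c hc hs).U),
          (-L).app ψ x = -(curvePatch I c hc hs).beltramiLaplace ψ x
            - (1 / 4) * (curvature c (x.1 0) : ℂ) ^ 2 * ψ x)) ∧
    -- surfaces
    (∀ S : Patch 2 3,
      -- tubular neighbourhoods exist locally
      (∀ x ∈ S.U, ∃ (V : TopologicalSpace.Opens (Fin 2 → ℝ)) (hV : V ≤ S.U), x ∈ V ∧
          Nonempty (Tube (S.restrict V hV) 1)) ∧
      -- for each of them there is exactly one submanifold Schrödinger operator `L`
      ∀ t : Tube S 1, ∃ L : D S.U,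
        (∀ L', t.IsSubmanifoldSchrodingerOperator L' ↔ L' = L) ∧
        -- it is given by the mean and Gauss curvatures
        (∀ (ψ : A S.U) (x : S.U), (-L).app ψ x = -S.beltramiLaplace ψ x
          - ((S.meanCurvature x : ℂ) ^ 2 - (S.gaussCurvature x : ℂ)) * ψ x) ∧
        -- and agrees with the operator `-Δ_S - (k₁ - k₂)² / 4` of Jensen-Koppe and da Costa,
        -- where `k₁`, `k₂` are the principal curvatures
        (∀ x : S.U, ∃ k₁ k₂ : ℝ, S.IsPrincipalCurvatures x k₁ k₂ ∧
          ∀ ψ : A S.U, (-L).app ψ x = -S.beltramiLaplace ψ x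
            - (1 / 4) * ((k₁ : ℂ) - (k₂ : ℂ)) ^ 2 * ψ x)) := by
  have hfinal : ∀ {k : ℕ} [NeZero k] {d : ℕ} {S : Patch k 3} (t : Tube S d) (ψ : A S.U) (x : S.U),
      (-t.submanifoldOperator).app ψ x =
        -S.beltramiLaplace ψ x + A.eval x (∑ a, t.potential a) * ψ x := by
    intro k _ d S t ψ x
    rw [D.app_neg]
    change -(t.submanifoldOperator.app ψ x) = _
    rw [t.submanifoldOperator_app]
    ring
  refine ⟨fun I c hc hs _ s₀ _ => ⟨fun x hx => exists_nonempty_tube_curvePatch I c hc hs x hx,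
    fun t => ⟨t.submanifoldOperator, fun L' =>
      t.isSubmanifoldSchrodingerOperator_iff rfl t.principal_submanifoldOperator L',
      fun ψ x => ?_, fun ψ x => ?_⟩⟩, fun S => ⟨fun x hx => ⟨S.U, le_rfl, hx, S.nonempty_tube⟩,
    fun t => ⟨t.submanifoldOperator, fun L' =>
      t.isSubmanifoldSchrodingerOperator_iff rfl t.principal_submanifoldOperator L',
      fun ψ x => ?_, fun x => ?_⟩⟩⟩
  · rw [hfinal, sum_potential_curvePatch, norm_complexCurvature, beltramiLaplace_curvePatch]
    ring
  · rw [hfinal, sum_potential_curvePatch]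
    ring
  · rw [hfinal, potential_surface]
    ring
  · obtain ⟨k₁, k₂, hk, h⟩ := S.exists_isPrincipalCurvatures x
    refine ⟨k₁, k₂, hk, fun ψ => ?_⟩
    have h' := congrArg (fun r : ℝ => (r : ℂ)) h
    push_cast at h'
    rw [hfinal, potential_surface, h']
    ring
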